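/- Let $G$ be a compact quantum group, given by its Hopf $*$-algebra $(\mathbb C[G],\Delta)$ of regular functions (a Hopf $*$-algebra with a faithful positive Haar state $h$), and let $C(G)$ be its reduced C$^*$-algebra, that is, the norm closure of $\mathbb C[G]$ in the GNS-representation of $h$. A unital Yetter--Drinfeld $G$-C$^*$-algebra is a nonzero unital C$^*$-algebra $A$ with * a continuous left action of $G$: an injective unital $*$-homomorphism $\alpha\colon A\to C(G)\otimes A$ (minimal tensor product) with $(\Delta\otimes\iota)\alpha=(\iota\otimes\alpha)\alpha$ and satisfying the Podleś condition; equivalently, the set $\mathcal A$ of regular elements, i.e. of those $a\in A$ for which $\alpha(a)$ lies in the algebraic tensor product $\mathbb C[G]\otimes_{\rm alg}A$, is dense in $A$, and coassociativity holds on $\mathcal A$; * a right action of the dual discrete quantum group $\hat G$, i.e. a left $\mathbb C[G]$-module algebra structure $x\rhd a$ on $A$ with $x\rhd a^*=(S(x)^*\rhd a)^*$; such that the Yetter--Drinfeld condition $\alpha(x\rhd a)=x_{(1)}a_{(1)}S(x_{(3)})\otimes(x_{(2)}\rhd a_{(2)})$ holds for all $x\in\mathbb C[G]$ and $a\in\mathcal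 A$, where $\alpha(a)=a_{(1)}\otimes a_{(2)}$. Equivalently, $A$ carries an action of the Drinfeld double $D(G)$. A unital completely positive (ucp) map $\phi\colon A\to B$ between such algebras is $D(G)$-equivariant if it is a $\mathbb C[G]$-module map and $\alpha_B(\phi(a))=(\iota\otimes\phi)\alpha_A(a)$ for all $a\in\mathcal A$. Isomorphisms are $D(G)$-equivariant $*$-isomorphisms. A unital Yetter--Drinfeld $G$-C$^*$-algebra $A$ is a $D(G)$-boundary if every $D(G)$-equivariant ucp map from $A$ to a unital Yetter--Drinfeld $G$-C$^*$-algebra is completely isometric. It is $D(G)$-injective if, for all unital Yetter--Drinfeld $G$-C$^*$-algebras $B$, $C$, every completely isometric $D(G)$-equivariant ucp map $\phi\colon B\to C$ and every $D(G)$-equivariant ucp map $\psi\colon B\to A$, there is a $D(G)$-equivariant ucp map $\tilde\psi\colon C\to A$ with $\tilde\psi\phi=\psi$. Let $C(\partial_{\rm FH}D(G))$ be the Furstenberg--Hamana boundary of $D(G)$, that is, a $D(G)$-boundary that is $D(G)$-injective (such a boundary is unique up to isomorphism). A unital Yetter--Drinfeld $G$-C$^*$-subalgebra of it is a closed unital $*$-subalgebra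 that is a Yetter--Drinfeld $G$-C$^*$-algebra for the restrictions of the two actions. Theorem. A unital Yetter--Drinfeld $G$-C$^*$-algebra is a $D(G)$-boundary if and only if it is isomorphic to a unital Yetter--Drinfeld $G$-C$^*$-subalgebra of $C(\partial_{\rm FH}D(G))$. Furthermore, let $A_1,A_2\subset C(\partial_{\rm FH}D(G))$ be two such subalgebras. If $A_1\subset A_2$, then the embedding $A_1\hookrightarrow A_2$ is the only $D(G)$-equivariant ucp map $A_1\to A_2$. If $A_1\not\subset A_2$, then there are no $D(G)$-equivariant ucp maps $A_1\to A_2$. -/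

import Mathlib

open scoped TensorProduct ComplexOrder InnerProductSpace

universe u

noncomputable section

/-! ### Minimal tensor product of unital C⋆-algebras -/

section HilbertTensor

variable (H K : Type u) [NormedAddCommGroup H] [InnerProductSpace ℂ H]
  [NormedAddCommGroup K] [InnerProductSpace ℂ K]

/-- The Hilbert space tensor product. -/
def HilbertTensor : Type u := UniformSpace.Completion (H ⊗[ℂ] K)

instance : NormedAddCommGroup (HilbertTensor H K) :=
  inferInstanceAs (NormedAddCommGroup (UniformSpace.Completion (H ⊗[ℂ] K)))
instance : InnerProductSpace ℂ (HilbertTensor H K) :=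
  inferInstanceAs (InnerProductSpace ℂ (UniformSpace.Completion (H ⊗[ℂ] K)))
instance : CompleteSpace (HilbertTensor H K) :=
  inferInstanceAs (CompleteSpace (UniformSpace.Completion (H ⊗[ℂ] K)))

variable {H K}

/-- The elementary tensor `x ⊗ y` in the Hilbert space tensor product. -/
def HilbertTensor.tmul (x : H) (y : K) : HilbertTensor H K :=
  ((x ⊗ₜ[ℂ] y : H ⊗[ℂ] K) : UniformSpace.Completion (H ⊗[ℂ] K))

/-- The bounded operator `f ⊗ g` on the Hilbert space tensor product. -/
def HilbertTensor.map (f : H →L[ℂ] H) (g : K →L[ℂ] K) :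
    HilbertTensor H K →L[ℂ] HilbertTensor H K :=
  (TensorProduct.mapL f g).completion

theorem HilbertTensor.map_tmul (f : H →L[ℂ] H) (g : K →L[ℂ] K) (x : H) (y : K) :
    HilbertTensor.map f g (HilbertTensor.tmul x y) = HilbertTensor.tmul (f x) (g y) := by
  exact ContinuousLinearMap.completion_apply_coe _ _

theorem HilbertTensor.inner_tmul (x x' : H) (y y' : K) :
    ⟪HilbertTensor.tmul x y, HilbertTensor.tmul x' y'⟫_ℂ = ⟪x, x'⟫_ℂ * ⟪y, y'⟫_ℂ :=
  (UniformSpace.Completion.inner_coe _ _).trans (TensorProduct.inner_tmul (𝕜 := ℂ) ..)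

theorem HilbertTensor.induction {P : HilbertTensor H K → Prop} (z : HilbertTensor H K)
    (hc : IsClosed {z | P z}) (ht : ∀ x y, P (HilbertTensor.tmul x y))
    (ha : ∀ z w, P z → P w → P (z + w)) : P z := by
  refine UniformSpace.Completion.induction_on (p := P) z hc fun t => ?_
  induction t with
  | zero =>
    have := ht 0 0
    simpa [HilbertTensor.tmul] using this
  | tmul x y => exact ht x y
  | add s t hs ht =>
    have := ha _ _ hs ht
    rwa [UniformSpace.Completion.coe_add]

theorem HilbertTensor.ext {S T : HilbertTensor H K →L[ℂ] HilbertTensor H K}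
    (h : ∀ x y, S (HilbertTensor.tmul x y) = T (HilbertTensor.tmul x y)) : S = T := by
  ext z
  refine HilbertTensor.induction (P := fun z => S z = T z) z
    (isClosed_eq S.continuous T.continuous) h fun z w hz hw => ?_
  simp only [map_add, hz, hw]

theorem HilbertTensor.map_mul (f f' : H →L[ℂ] H) (g g' : K →L[ℂ] K) :
    HilbertTensor.map (f * f') (g * g') = HilbertTensor.map f g * HilbertTensor.map f' g' :=
  HilbertTensor.ext fun x y => by
    simp only [mul_apply_eq_comp, HilbertTensor.map_tmul]

theorem HilbertTensor.map_one_one :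
    HilbertTensor.map (1 : H →L[ℂ] H) (1 : K →L[ℂ] K) = 1 :=
  HilbertTensor.ext fun x y => by simp [HilbertTensor.map_tmul]

theorem HilbertTensor.add_tmul (x x' : H) (y : K) :
    HilbertTensor.tmul (x + x') y = HilbertTensor.tmul x y + HilbertTensor.tmul x' y := by
  simp only [HilbertTensor.tmul, TensorProduct.add_tmul]
  exact UniformSpace.Completion.coe_add _ _

theorem HilbertTensor.tmul_add (x : H) (y y' : K) :
    HilbertTensor.tmul x (y + y') = HilbertTensor.tmul x y + HilbertTensor.tmul x y' := by
  simp only [HilbertTensor.tmul, TensorProduct.tmul_add]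
  exact UniformSpace.Completion.coe_add _ _

theorem HilbertTensor.smul_tmul (c : ℂ) (x : H) (y : K) :
    HilbertTensor.tmul (c • x) y = c • HilbertTensor.tmul x y := by
  simp only [HilbertTensor.tmul, ← TensorProduct.smul_tmul']
  exact UniformSpace.Completion.coe_smul _ _

theorem HilbertTensor.tmul_smul (c : ℂ) (x : H) (y : K) :
    HilbertTensor.tmul x (c • y) = c • HilbertTensor.tmul x y := by
  simp only [HilbertTensor.tmul, TensorProduct.tmul_smul]
  exact UniformSpace.Completion.coe_smul _ _

theorem HilbertTensor.star_map [CompleteSpace H] [CompleteSpace K]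
    (f : H →L[ℂ] H) (g : K →L[ℂ] K) :
    HilbertTensor.map (star f) (star g) = star (HilbertTensor.map f g) := by
  rw [ContinuousLinearMap.star_eq_adjoint (HilbertTensor.map f g),
    ContinuousLinearMap.eq_adjoint_iff]
  intro z w
  refine HilbertTensor.induction
    (P := fun z => ⟪HilbertTensor.map (star f) (star g) z, w⟫_ℂ = ⟪z, HilbertTensor.map f g w⟫_ℂ)
    z (isClosed_eq (by fun_prop) (by fun_prop)) (fun x y => ?_) fun z z' hz hz' => ?_
  · refine HilbertTensor.induction (P := fun w =>
      ⟪HilbertTensor.map (star f) (star g) (HilbertTensor.tmul x y), w⟫_ℂ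
        = ⟪HilbertTensor.tmul x y, HilbertTensor.map f g w⟫_ℂ)
      w (isClosed_eq (by fun_prop) (by fun_prop)) (fun x' y' => ?_) fun w w' hw hw' => ?_
    · simp only [HilbertTensor.map_tmul, HilbertTensor.inner_tmul,
        ContinuousLinearMap.star_eq_adjoint, ContinuousLinearMap.adjoint_inner_left]
    · simp only [map_add, inner_add_right, hw, hw']
  · simp only [map_add, inner_add_left, hz, hz']

variable (H K) in
/-- The `⋆`-homomorphism `f ↦ f ⊗ 1`. -/
def HilbertTensor.ampLeft [CompleteSpace H] [CompleteSpace K] :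
    (H →L[ℂ] H) →⋆ₐ[ℂ] (HilbertTensor H K →L[ℂ] HilbertTensor H K) where
  toFun f := HilbertTensor.map f 1
  map_one' := HilbertTensor.map_one_one
  map_mul' f g := by
    rw [← HilbertTensor.map_mul, one_mul]
  map_zero' := HilbertTensor.ext fun x y => by
    have := HilbertTensor.smul_tmul 0 x y
    simpa [HilbertTensor.map_tmul] using this
  map_add' f g := HilbertTensor.ext fun x y => by
    simp [HilbertTensor.map_tmul, HilbertTensor.add_tmul]
  commutes' c := HilbertTensor.ext fun x y => by
    simp [HilbertTensor.map_tmul, HilbertTensor.smul_tmul, Algebra.algebraMap_eq_smul_one]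
  map_star' f := by
    rw [← HilbertTensor.star_map, star_one]

variable (H K) in
/-- The `⋆`-homomorphism `g ↦ 1 ⊗ g`. -/
def HilbertTensor.ampRight [CompleteSpace H] [CompleteSpace K] :
    (K →L[ℂ] K) →⋆ₐ[ℂ] (HilbertTensor H K →L[ℂ] HilbertTensor H K) where
  toFun f := HilbertTensor.map 1 f
  map_one' := HilbertTensor.map_one_one
  map_mul' f g := by
    rw [← HilbertTensor.map_mul, one_mul]
  map_zero' := HilbertTensor.ext fun x y => by
    have := HilbertTensor.tmul_smul 0 x y
    simpa [HilbertTensor.map_tmul] using this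
  map_add' f g := HilbertTensor.ext fun x y => by
    simp [HilbertTensor.map_tmul, HilbertTensor.tmul_add]
  commutes' c := HilbertTensor.ext fun x y => by
    simp [HilbertTensor.map_tmul, HilbertTensor.tmul_smul, Algebra.algebraMap_eq_smul_one]
  map_star' f := by
    rw [← HilbertTensor.star_map, star_one]

end HilbertTensor

/-- A unital `⋆`-representation of `A` on a Hilbert space. -/
structure HilbertRep (A : Type u) [CStarAlgebra A] : Type (u + 1) where
  space : Type u
  [normedAddCommGroup : NormedAddCommGroup space]
  [innerProductSpace : InnerProductSpace ℂ space]
  [completeSpace : CompleteSpace space]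
  hom : A →⋆ₐ[ℂ] (space →L[ℂ] space)

attribute [instance] HilbertRep.normedAddCommGroup HilbertRep.innerProductSpace
  HilbertRep.completeSpace

section MinTensor

variable {A B : Type u} [CStarAlgebra A] [CStarAlgebra B]

/-- The representation `a ↦ ρ(a) ⊗ 1`. -/
def HilbertRep.left (ρ : HilbertRep A) (σ : HilbertRep B) :
    A →⋆ₐ[ℂ] (HilbertTensor ρ.space σ.space →L[ℂ] HilbertTensor ρ.space σ.space) :=
  (HilbertTensor.ampLeft ρ.space σ.space).comp ρ.hom

/-- The representation `b ↦ 1 ⊗ σ(b)`. -/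
def HilbertRep.right (ρ : HilbertRep A) (σ : HilbertRep B) :
    B →⋆ₐ[ℂ] (HilbertTensor ρ.space σ.space →L[ℂ] HilbertTensor ρ.space σ.space) :=
  (HilbertTensor.ampRight ρ.space σ.space).comp σ.hom

theorem HilbertRep.left_mul_right (ρ : HilbertRep A) (σ : HilbertRep B) (a : A) (b : B) :
    ρ.left σ a * ρ.right σ b = HilbertTensor.map (ρ.hom a) (σ.hom b) :=
  HilbertTensor.ext fun x y => by
    simp [HilbertRep.left, HilbertRep.right, HilbertTensor.ampLeft, HilbertTensor.ampRight,
      HilbertTensor.map_tmul]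

theorem HilbertRep.right_mul_left (ρ : HilbertRep A) (σ : HilbertRep B) (a : A) (b : B) :
    ρ.right σ b * ρ.left σ a = HilbertTensor.map (ρ.hom a) (σ.hom b) :=
  HilbertTensor.ext fun x y => by
    simp [HilbertRep.left, HilbertRep.right, HilbertTensor.ampLeft, HilbertTensor.ampRight,
      HilbertTensor.map_tmul]

/-- The representation `ρ ⊗ σ` of the algebraic tensor product `A ⊗ B`, characterized by
`(ρ ⊗ σ)(a ⊗ b) = ρ(a) ⊗ σ(b)`. -/
def HilbertRep.tensor (ρ : HilbertRep A) (σ : HilbertRep B) :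
    A ⊗[ℂ] B →ₐ[ℂ] (HilbertTensor ρ.space σ.space →L[ℂ] HilbertTensor ρ.space σ.space) :=
  Algebra.TensorProduct.lift (ρ.left σ).toAlgHom (ρ.right σ).toAlgHom fun a b =>
    (ρ.left_mul_right σ a b).trans (ρ.right_mul_left σ a b).symm

theorem HilbertRep.tensor_tmul (ρ : HilbertRep A) (σ : HilbertRep B) (a : A) (b : B) :
    ρ.tensor σ (a ⊗ₜ[ℂ] b) = HilbertTensor.map (ρ.hom a) (σ.hom b) :=
  (Algebra.TensorProduct.lift_tmul _ _ _ a b).trans (ρ.left_mul_right σ a b)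

theorem HilbertRep.tensor_star (ρ : HilbertRep A) (σ : HilbertRep B) (t : A ⊗[ℂ] B) :
    ρ.tensor σ (star t) = star (ρ.tensor σ t) := by
  induction t with
  | zero => simp
  | add s t hs ht => simp [hs, ht]
  | tmul a b => simp [HilbertRep.tensor_tmul, map_star, HilbertTensor.star_map]

theorem HilbertRep.exists_norm_tensor_le (t : A ⊗[ℂ] B) :
    ∃ C : ℝ, ∀ p : HilbertRep A × HilbertRep B, ‖p.1.tensor p.2 t‖ ≤ C := by
  induction t with
  | zero => exact ⟨0, fun p => by simp⟩
  | add s t hs ht =>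
    obtain ⟨C, hC⟩ := hs
    obtain ⟨D, hD⟩ := ht
    exact ⟨C + D, fun p => by
      rw [map_add]; exact (norm_add_le _ _).trans (add_le_add (hC p) (hD p))⟩
  | tmul a b =>
    refine ⟨‖a‖ * ‖b‖, fun p => ?_⟩
    rw [HilbertRep.tensor_tmul, ← HilbertRep.left_mul_right]
    exact (norm_mul_le _ _).trans (mul_le_mul (NonUnitalStarAlgHom.norm_apply_le (p.1.left p.2) a)
      (NonUnitalStarAlgHom.norm_apply_le (p.1.right p.2) b) (norm_nonneg _) (norm_nonneg _))

/-- The minimal (spatial) norm on the algebraic tensor product: the supremum of the norms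
`‖(ρ ⊗ σ)(t)‖` over all pairs of representations. -/
def minNorm (t : A ⊗[ℂ] B) : ℝ :=
  ⨆ p : HilbertRep A × HilbertRep B, ‖p.1.tensor p.2 t‖

theorem norm_tensor_le_minNorm (t : A ⊗[ℂ] B) (p : HilbertRep A × HilbertRep B) :
    ‖p.1.tensor p.2 t‖ ≤ minNorm t := by
  obtain ⟨C, hC⟩ := HilbertRep.exists_norm_tensor_le t
  exact le_ciSup (f := fun p : HilbertRep A × HilbertRep B => ‖p.1.tensor p.2 t‖)
    ⟨C, by rintro _ ⟨q, rfl⟩; exact hC q⟩ p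

theorem minNorm_nonneg (t : A ⊗[ℂ] B) : 0 ≤ minNorm t :=
  Real.iSup_nonneg fun _ => norm_nonneg _

theorem minNorm_star (t : A ⊗[ℂ] B) : minNorm (star t) = minNorm t := by
  simp only [minNorm, HilbertRep.tensor_star, norm_star]

theorem minNorm_mul_self_le (t : A ⊗[ℂ] B) : minNorm t * minNorm t ≤ minNorm (star t * t) := by
  have h : minNorm t ≤ √(minNorm (star t * t)) :=
    Real.iSup_le (fun p => Real.le_sqrt_of_sq_le (by
      rw [sq, ← CStarRing.norm_star_mul_self, ← HilbertRep.tensor_star, ← map_mul]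
      exact norm_tensor_le_minNorm _ p)) (Real.sqrt_nonneg _)
  calc _ ≤ √(minNorm (star t * t)) * √(minNorm (star t * t)) :=
        mul_self_le_mul_self (minNorm_nonneg t) h
    _ = _ := Real.mul_self_sqrt (minNorm_nonneg _)

variable (A B) in
/-- The algebraic tensor product, to be equipped with the minimal norm. -/
def PreMinTensor : Type u := A ⊗[ℂ] B

instance : Ring (PreMinTensor A B) := inferInstanceAs (Ring (A ⊗[ℂ] B))
instance : Algebra ℂ (PreMinTensor A B) := inferInstanceAs (Algebra ℂ (A ⊗[ℂ] B))
instance : StarRing (PreMinTensor A B) := inferInstanceAs (StarRing (A ⊗[ℂ] B))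
instance : StarModule ℂ (PreMinTensor A B) := inferInstanceAs (StarModule ℂ (A ⊗[ℂ] B))
instance : Norm (PreMinTensor A B) := ⟨fun t => minNorm (A := A) (B := B) t⟩

theorem PreMinTensor.core : SeminormedSpace.Core ℂ (PreMinTensor A B) where
  norm_nonneg := minNorm_nonneg
  norm_smul c t := by
    show minNorm (A := A) (B := B) (c • (show A ⊗[ℂ] B from t)) = ‖c‖ * minNorm _
    unfold minNorm
    rw [Real.mul_iSup_of_nonneg (norm_nonneg c)]
    exact iSup_congr fun p => by rw [map_smul, norm_smul]
  norm_triangle s t :=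
    Real.iSup_le (fun p => by
      show ‖p.1.tensor p.2 ((show A ⊗[ℂ] B from s) + (show A ⊗[ℂ] B from t))‖ ≤ _
      rw [map_add]
      exact (norm_add_le _ _).trans
        (add_le_add (norm_tensor_le_minNorm s p) (norm_tensor_le_minNorm t p)))
      (add_nonneg (minNorm_nonneg _) (minNorm_nonneg _))

instance : SeminormedRing (PreMinTensor A B) :=
  { SeminormedAddCommGroup.ofCore PreMinTensor.core,
    (inferInstance : Ring (PreMinTensor A B)) with
    norm_mul_le := fun s t =>
      Real.iSup_le (fun p => by
        show ‖p.1.tensor p.2 ((show A ⊗[ℂ] B from s) * (show A ⊗[ℂ] B from t))‖ ≤ _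
        rw [map_mul]
        exact (norm_mul_le _ _).trans (mul_le_mul (norm_tensor_le_minNorm s p)
          (norm_tensor_le_minNorm t p) (norm_nonneg _) (minNorm_nonneg _)))
        (mul_nonneg (minNorm_nonneg _) (minNorm_nonneg _)) }

instance : NormedAlgebra ℂ (PreMinTensor A B) where
  norm_smul_le c t := (PreMinTensor.core.norm_smul c t).le

instance : NormedStarGroup (PreMinTensor A B) where
  norm_star_le t := (minNorm_star (A := A) (B := B) t).le

variable (A B) in
/-- The minimal tensor product of two unital C⋆-algebras: the completion of the algebraic tensor
product in the minimal norm. -/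
def MinTensor : Type u := UniformSpace.Completion (PreMinTensor A B)

instance : NormedRing (MinTensor A B) :=
  inferInstanceAs (NormedRing (UniformSpace.Completion (PreMinTensor A B)))
instance : CompleteSpace (MinTensor A B) :=
  inferInstanceAs (CompleteSpace (UniformSpace.Completion (PreMinTensor A B)))
instance : Algebra ℂ (MinTensor A B) :=
  inferInstanceAs (Algebra ℂ (UniformSpace.Completion (PreMinTensor A B)))

instance : NormedAlgebra ℂ (MinTensor A B) where
  norm_smul_le c x := by
    refine UniformSpace.Completion.induction_on
      (p := fun x : MinTensor A B => ‖c • x‖ ≤ ‖c‖ * ‖x‖) x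
      (isClosed_le ?_ (continuous_const.mul continuous_norm)) fun t => ?_
    · have h : (fun x : MinTensor A B => c • x) = fun x => algebraMap ℂ _ c * x :=
        funext fun x => Algebra.smul_def c x
      have hc : Continuous fun x : MinTensor A B => c • x := by
        rw [h]; exact continuous_const.mul continuous_id
      exact hc.norm
    · have h : c • (t : UniformSpace.Completion (PreMinTensor A B))
          = ((c • t : PreMinTensor A B) : UniformSpace.Completion (PreMinTensor A B)) :=
        (UniformSpace.Completion.coe_smul c t).symm
      refine (congrArg norm h).le.trans ?_
      refine (UniformSpace.Completion.norm_coe (c • t)).le.trans ?_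
      refine (norm_smul_le c t).trans (le_of_eq ?_)
      exact congrArg (‖c‖ * ·) (UniformSpace.Completion.norm_coe t).symm

/-- The canonical map from the algebraic tensor product. -/
def MinTensor.of (t : A ⊗[ℂ] B) : MinTensor A B :=
  ((show PreMinTensor A B from t) : UniformSpace.Completion (PreMinTensor A B))

theorem MinTensor.norm_of (t : A ⊗[ℂ] B) : ‖MinTensor.of t‖ = minNorm t :=
  UniformSpace.Completion.norm_coe (show PreMinTensor A B from t)

theorem MinTensor.of_mul (s t : A ⊗[ℂ] B) :
    MinTensor.of (s * t) = MinTensor.of s * MinTensor.of t :=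
  UniformSpace.Completion.coe_mul (show PreMinTensor A B from s) (show PreMinTensor A B from t)

theorem MinTensor.of_add (s t : A ⊗[ℂ] B) :
    MinTensor.of (s + t) = MinTensor.of s + MinTensor.of t :=
  UniformSpace.Completion.coe_add (show PreMinTensor A B from s) (show PreMinTensor A B from t)

theorem MinTensor.of_smul (c : ℂ) (t : A ⊗[ℂ] B) :
    MinTensor.of (c • t) = c • MinTensor.of t :=
  UniformSpace.Completion.coe_smul c (show PreMinTensor A B from t)

theorem MinTensor.induction {P : MinTensor A B → Prop} (x : MinTensor A B)
    (hc : IsClosed {x | P x}) (h : ∀ t, P (MinTensor.of t)) : P x :=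
  UniformSpace.Completion.induction_on x hc h

instance : Star (MinTensor A B) :=
  ⟨UniformSpace.Completion.map (star : PreMinTensor A B → PreMinTensor A B)⟩

theorem MinTensor.continuous_star : Continuous (star : MinTensor A B → MinTensor A B) :=
  UniformSpace.Completion.continuous_map

theorem MinTensor.of_star (t : A ⊗[ℂ] B) : MinTensor.of (star t) = star (MinTensor.of t) :=
  (UniformSpace.Completion.map_coe
    (star_isometry (E := PreMinTensor A B)).uniformContinuous
    (show PreMinTensor A B from t)).symm

instance : StarRing (MinTensor A B) where
  star_involutive x := by
    refine MinTensor.induction (P := fun x => star (star x) = x) x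
      (isClosed_eq (MinTensor.continuous_star.comp MinTensor.continuous_star) continuous_id)
      fun t => ?_
    rw [← MinTensor.of_star, ← MinTensor.of_star, star_star]
  star_mul x y := by
    refine MinTensor.induction (P := fun x => star (x * y) = star y * star x) x
      (isClosed_eq (MinTensor.continuous_star.comp (continuous_id.mul continuous_const))
        (continuous_const.mul MinTensor.continuous_star)) fun s => ?_
    refine MinTensor.induction
      (P := fun y => star (MinTensor.of s * y) = star y * star (MinTensor.of s)) y
      (isClosed_eq (MinTensor.continuous_star.comp (continuous_const.mul continuous_id))
        (MinTensor.continuous_star.mul continuous_const)) fun t => ?_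
    simp only [← MinTensor.of_star, ← MinTensor.of_mul, star_mul]
  star_add x y := by
    refine MinTensor.induction (P := fun x => star (x + y) = star x + star y) x
      (isClosed_eq (MinTensor.continuous_star.comp (continuous_id.add continuous_const))
        (MinTensor.continuous_star.add continuous_const)) fun s => ?_
    refine MinTensor.induction
      (P := fun y => star (MinTensor.of s + y) = star (MinTensor.of s) + star y) y
      (isClosed_eq (MinTensor.continuous_star.comp (continuous_const.add continuous_id))
        (continuous_const.add MinTensor.continuous_star)) fun t => ?_
    simp only [← MinTensor.of_star, ← MinTensor.of_add, star_add]

instance : StarModule ℂ (MinTensor A B) where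
  star_smul c x := by
    refine MinTensor.induction (P := fun x => star (c • x) = star c • star x) x
      (isClosed_eq (MinTensor.continuous_star.comp (continuous_const_smul c))
        ((continuous_const_smul _).comp MinTensor.continuous_star)) fun t => ?_
    simp only [← MinTensor.of_star, ← MinTensor.of_smul, star_smul]

instance : CStarRing (MinTensor A B) where
  norm_mul_self_le x := by
    refine MinTensor.induction (P := fun x => ‖x‖ * ‖x‖ ≤ ‖star x * x‖) x
      (isClosed_le (continuous_norm.mul continuous_norm)
        (MinTensor.continuous_star.mul continuous_id).norm) fun t => ?_
    rw [← MinTensor.of_star, ← MinTensor.of_mul, MinTensor.norm_of, MinTensor.norm_of]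
    exact minNorm_mul_self_le t

instance : CStarAlgebra (MinTensor A B) where

variable (A B) in
/-- The canonical `⋆`-homomorphism from the algebraic to the minimal tensor product. -/
def MinTensor.ofHom : A ⊗[ℂ] B →⋆ₐ[ℂ] MinTensor A B where
  toFun := MinTensor.of
  map_one' := rfl
  map_mul' := MinTensor.of_mul
  map_zero' := rfl
  map_add' := MinTensor.of_add
  commutes' _ := rfl
  map_star' := MinTensor.of_star

end MinTensor

/-! ### Compact quantum groups in the reduced form -/

/-- A compact quantum group `G`, given by the Hopf `⋆`-algebra `O = ℂ[G]` of regular functions: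
a Hopf `⋆`-algebra that has a faithful positive Haar state. -/
class CompactQuantumGroup (O : Type u) [Ring O] [StarRing O] [HopfAlgebra ℂ O]
    [StarModule ℂ O] where
  comul_star : ∀ x : O, Coalgebra.comul (R := ℂ) (star x) = star (Coalgebra.comul (R := ℂ) x)
  haar : O →ₗ[ℂ] ℂ
  haar_one : haar 1 = 1
  /-- `(h ⊗ ι)Δ(x) = h(x)1` -/
  haar_left : ∀ x : O, TensorProduct.lid ℂ O (haar.rTensor O (Coalgebra.comul x)) = haar x • 1
  /-- `(ι ⊗ h)Δ(x) = h(x)1` -/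
  haar_right : ∀ x : O, TensorProduct.rid ℂ O (haar.lTensor O (Coalgebra.comul x)) = haar x • 1
  haar_pos : ∀ x : O, x ≠ 0 → 0 < haar (star x * x)

section Reduced

open CompactQuantumGroup

variable (O : Type u) [Ring O] [StarRing O] [HopfAlgebra ℂ O] [StarModule ℂ O]
  [CompactQuantumGroup O]

variable {O} in
theorem CompactQuantumGroup.haar_nonneg (x : O) : 0 ≤ haar (star x * x) := by
  rcases eq_or_ne x 0 with rfl | h
  · simp
  · exact (haar_pos x h).le

variable {O} in
theorem CompactQuantumGroup.haar_star (x : O) : haar (star x) = star (haar x) := by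
  have him : ∀ y : O, (haar (star y * y)).im = 0 := fun y =>
    (Complex.le_def.1 (haar_nonneg y)).2.symm
  have h0 := him x
  have h1 := him (1 + x)
  have h2 := him (1 + Complex.I • x)
  simp only [star_add, star_one, star_smul, add_mul, mul_add, one_mul, mul_one, map_add,
    smul_mul_assoc, mul_smul_comm, map_smul, haar_one, Complex.add_im, smul_eq_mul] at h1 h2
  simp at h1 h2
  apply Complex.ext
  · simp; linarith
  · simp; linarith

/-- `ℂ[G]` with the inner product `⟨x, y⟩ = h(x⋆ y)`. -/
def PreL2 : Type u := O

instance : AddCommGroup (PreL2 O) := inferInstanceAs (AddCommGroup O)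
instance : Module ℂ (PreL2 O) := inferInstanceAs (Module ℂ O)

/-- The identity map. -/
def toPreL2 : O ≃ₗ[ℂ] PreL2 O := LinearEquiv.refl ℂ O

instance PreL2.core : InnerProductSpace.Core ℂ (PreL2 O) where
  inner x y := haar (star ((toPreL2 O).symm x) * (toPreL2 O).symm y)
  conj_inner_symm x y := by
    rw [← Complex.star_def, ← haar_star]; simp
  re_inner_nonneg x := (Complex.le_def.1 (haar_nonneg ((toPreL2 O).symm x))).1
  add_left x y z := by simp [add_mul]
  smul_left x y c := by simp
  definite x hx := by
    by_contra h
    exact (haar_pos ((toPreL2 O).symm x) (by simpa using h)).ne' hx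

instance : NormedAddCommGroup (PreL2 O) := (PreL2.core O).toNormedAddCommGroup
instance : InnerProductSpace ℂ (PreL2 O) := InnerProductSpace.ofCore (PreL2.core O).toCore

theorem PreL2.inner_def (x y : O) :
    ⟪toPreL2 O x, toPreL2 O y⟫_ℂ = haar (star x * y) := rfl

/-- The GNS space `L²(G)` of the Haar state. -/
abbrev L2 : Type u := UniformSpace.Completion (PreL2 O)

variable {O} in
/-- Left multiplication by a regular function is bounded on the GNS space. -/
theorem CompactQuantumGroup.exists_bound (x : O) :
    ∃ C : ℝ, ∀ y : O, ‖toPreL2 O (x * y)‖ ≤ C * ‖toPreL2 O y‖ := by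
  classical
  obtain ⟨V, hV, hx⟩ := TensorProduct.exists_finite_submodule_left_of_setFinite
    (R := ℂ) (M := PreL2 O) (N := O)
    {(toPreL2 O).toLinearMap.rTensor O (Coalgebra.comul (R := ℂ) x)} (Set.finite_singleton _)
  obtain ⟨t, ht⟩ := hx (Set.mem_singleton _)
  have : FiniteDimensional ℂ V := hV
  let e := stdOrthonormalBasis ℂ V
  obtain ⟨c, hc⟩ := TensorProduct.eq_repr_basis_left e.toBasis t
  let v : Fin (Module.finrank ℂ V) → O := fun i => (toPreL2 O).symm (e i : PreL2 O)
  have hcomul : Coalgebra.comul (R := ℂ) x = ∑ i, v i ⊗ₜ[ℂ] c i := by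
    have h1 : (toPreL2 O).symm.toLinearMap.rTensor O
        ((toPreL2 O).toLinearMap.rTensor O (Coalgebra.comul (R := ℂ) x))
        = Coalgebra.comul (R := ℂ) x := by
      rw [← LinearMap.comp_apply, ← LinearMap.rTensor_comp]
      simp
    rw [← h1, ← ht, ← hc, Finsupp.sum_fintype _ _ (by simp)]
    simp [v]
  have horth : ∀ i j, haar (star (v i) * v j) = if i = j then 1 else 0 := by
    intro i j
    have h := orthonormal_iff_ite.1 e.orthonormal i j
    rw [← h]
    rfl
  have hsum : ∑ i, star (c i) * c i = haar (star x * x) • (1 : O) := by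
    rw [← haar_left, Bialgebra.comul_mul, comul_star, hcomul]
    simp only [star_sum, TensorProduct.star_tmul, Finset.sum_mul_sum,
      Algebra.TensorProduct.tmul_mul_tmul, map_sum, LinearMap.rTensor_tmul,
      TensorProduct.lid_tmul, horth, ite_smul, one_smul, zero_smul]
    simp
  have hbd : ∀ i, ∀ y : O, ‖toPreL2 O (c i * y)‖ ^ 2
      ≤ (haar (star x * x)).re * ‖toPreL2 O y‖ ^ 2 := by
    intro i y
    have hn : ∀ z : O, ‖toPreL2 O z‖ ^ 2 = (haar (star z * z)).re := fun z => by
      rw [← PreL2.inner_def, ← inner_self_eq_norm_sq (𝕜 := ℂ)]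
      rfl
    have h1 : ∑ j, (haar (star (c j * y) * (c j * y))).re
        = (haar (star x * x)).re * (haar (star y * y)).re := by
      rw [← Complex.re_sum, ← map_sum]
      have h2 : ∑ j, star (c j * y) * (c j * y) = haar (star x * x) • (star y * y) := by
        have h3 : ∑ j, star (c j * y) * (c j * y) = star y * (∑ j, star (c j) * c j) * y := by
          simp only [Finset.mul_sum, Finset.sum_mul, star_mul, mul_assoc]
        rw [h3, hsum]
        simp
      rw [h2, map_smul, smul_eq_mul, Complex.mul_re]
      have him : (haar (star x * x)).im = 0 := (Complex.le_def.1 (haar_nonneg x)).2.symm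
      rw [him]; ring
    rw [hn, hn, ← h1]
    exact Finset.single_le_sum (f := fun j => (haar (star (c j * y) * (c j * y))).re)
      (fun j _ => (Complex.le_def.1 (haar_nonneg (c j * y))).1) (Finset.mem_univ i)
  have hexp : x = ∑ i, Coalgebra.counit (R := ℂ) (v i) • c i := by
    have h := Coalgebra.rTensor_counit_comul (R := ℂ) x
    rw [hcomul] at h
    have h2 := congrArg (TensorProduct.lid ℂ O) h
    simpa using h2.symm
  refine ⟨∑ i, ‖Coalgebra.counit (R := ℂ) (v i)‖ * √(haar (star x * x)).re, fun y => ?_⟩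
  have hxy : toPreL2 O (x * y)
      = ∑ i, Coalgebra.counit (R := ℂ) (v i) • toPreL2 O (c i * y) := by
    conv_lhs => rw [hexp]
    simp [Finset.sum_mul]
  rw [hxy, Finset.sum_mul]
  refine (norm_sum_le _ _).trans (Finset.sum_le_sum fun i _ => ?_)
  rw [norm_smul, mul_assoc]
  refine mul_le_mul_of_nonneg_left ?_ (norm_nonneg _)
  have hre : 0 ≤ (haar (star x * x)).re := (Complex.le_def.1 (haar_nonneg x)).1
  refine le_of_sq_le_sq ?_ (by positivity)
  rw [mul_pow, Real.sq_sqrt hre]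
  exact hbd i y

/-- Left multiplication by `x` on the GNS space. -/
def leftMulPreL2 (x : O) : PreL2 O →L[ℂ] PreL2 O :=
  ((toPreL2 O).toLinearMap ∘ₗ LinearMap.mulLeft ℂ x ∘ₗ
    (toPreL2 O).symm.toLinearMap).mkContinuousOfExistsBound (by
      obtain ⟨C, hC⟩ := exists_bound x
      exact ⟨C, fun y => hC ((toPreL2 O).symm y)⟩)

theorem leftMulPreL2_apply (x y : O) :
    leftMulPreL2 O x (toPreL2 O y) = toPreL2 O (x * y) := rfl

/-- The GNS representation of `ℂ[G]` on `L²(G)` by left multiplication. -/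
def gnsRep : O →⋆ₐ[ℂ] (L2 O →L[ℂ] L2 O) where
  toFun x := (leftMulPreL2 O x).completion
  map_one' := by
    ext z
    refine UniformSpace.Completion.induction_on z
      (isClosed_eq (by fun_prop) (by fun_prop)) fun y => ?_
    obtain ⟨y, rfl⟩ := (toPreL2 O).surjective y
    simp [leftMulPreL2_apply]
  map_mul' a b := by
    ext z
    refine UniformSpace.Completion.induction_on z
      (isClosed_eq (by fun_prop) (by fun_prop)) fun y => ?_
    obtain ⟨y, rfl⟩ := (toPreL2 O).surjective y
    simp [leftMulPreL2_apply, mul_assoc]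
  map_zero' := by
    ext z
    refine UniformSpace.Completion.induction_on z
      (isClosed_eq (by fun_prop) (by fun_prop)) fun y => ?_
    obtain ⟨y, rfl⟩ := (toPreL2 O).surjective y
    simp [leftMulPreL2_apply]
  map_add' a b := by
    ext z
    refine UniformSpace.Completion.induction_on z
      (isClosed_eq (by fun_prop) (by fun_prop)) fun y => ?_
    obtain ⟨y, rfl⟩ := (toPreL2 O).surjective y
    simp [leftMulPreL2_apply, add_mul, UniformSpace.Completion.coe_add]
  commutes' c := by
    ext z
    refine UniformSpace.Completion.induction_on z
      (isClosed_eq (by fun_prop) (by fun_prop)) fun y => ?_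
    obtain ⟨y, rfl⟩ := (toPreL2 O).surjective y
    simp [leftMulPreL2_apply, Algebra.algebraMap_eq_smul_one, UniformSpace.Completion.coe_smul]
  map_star' a := by
    rw [ContinuousLinearMap.star_eq_adjoint, ContinuousLinearMap.eq_adjoint_iff]
    intro z w
    refine UniformSpace.Completion.induction_on₂ z w
      (isClosed_eq (by fun_prop) (by fun_prop)) fun x y => ?_
    obtain ⟨x, rfl⟩ := (toPreL2 O).surjective x
    obtain ⟨y, rfl⟩ := (toPreL2 O).surjective y
    simp [leftMulPreL2_apply, PreL2.inner_def, mul_assoc]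

/-- The reduced C⋆-algebra `C(G)`: the norm closure of `ℂ[G]` in the GNS representation of the
Haar state. -/
def ReducedCStar : StarSubalgebra ℂ (L2 O →L[ℂ] L2 O) := (gnsRep O).range.topologicalClosure

instance : IsClosed (ReducedCStar O : Set (L2 O →L[ℂ] L2 O)) :=
  StarSubalgebra.isClosed_topologicalClosure _

/-- The embedding `ℂ[G] → C(G)`. -/
def toReduced : O →⋆ₐ[ℂ] ReducedCStar O :=
  (gnsRep O).codRestrict _ fun x =>
    StarSubalgebra.le_topologicalClosure _ ⟨x, rfl⟩

end Reduced
/-! ### Actions of `G`, of its dual, and Yetter–Drinfeld algebras -/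

section Actions

open Coalgebra

variable (O : Type u) [Ring O] [StarRing O] [HopfAlgebra ℂ O] [StarModule ℂ O]
  [CompactQuantumGroup O]

/-- The embedding of the algebraic tensor product `ℂ[G] ⊗ A` into `C(G) ⊗ A`. -/
def regularEmb (A : Type u) [CStarAlgebra A] : O ⊗[ℂ] A →ₐ[ℂ] MinTensor (ReducedCStar O) A :=
  (MinTensor.ofHom (ReducedCStar O) A).toAlgHom.comp
    (Algebra.TensorProduct.map (toReduced O).toAlgHom (AlgHom.id ℂ A))

/-- A (continuous) left action of `G` on a unital C⋆-algebra `A`: an injective unital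
`⋆`-homomorphism `α : A → C(G) ⊗ A` with `(Δ ⊗ ι)α = (ι ⊗ α)α` that satisfies the Podleś
condition. An element `a` is regular if `α(a)` lies in the algebraic tensor product `ℂ[G] ⊗ A`.
The Podleś condition is stated as density of the regular elements, and coassociativity on this
dense subset, where both sides lie in `ℂ[G] ⊗ (C(G) ⊗ A)` with the first tensor product
algebraic. -/
structure QAction (A : Type u) [CStarAlgebra A] where
  coact : A →⋆ₐ[ℂ] MinTensor (ReducedCStar O) A
  coact_injective : Function.Injective coact
  dense_regular : Dense {a : A | ∃ t : O ⊗[ℂ] A, coact a = regularEmb O A t}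
  coassoc : ∀ (a : A) (t : O ⊗[ℂ] A), coact a = regularEmb O A t →
    (regularEmb O A).toLinearMap.lTensor O
        (TensorProduct.assoc ℂ O O A ((comul : O →ₗ[ℂ] O ⊗[ℂ] O).rTensor A t))
      = coact.toAlgHom.toLinearMap.lTensor O t

/-- A right action of the dual discrete quantum group on a unital C⋆-algebra `A`, in its algebraic
description: a left `ℂ[G]`-module algebra structure `x ▹ a = act x a` on `A` such that
`x ▹ a⋆ = (S(x)⋆ ▹ a)⋆`. -/
structure DualAction (A : Type u) [CStarAlgebra A] where
  act : O →ₐ[ℂ] Module.End ℂ A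
  /-- `x ▹ (ab) = (x₍₁₎ ▹ a)(x₍₂₎ ▹ b)` -/
  act_mul : ∀ (x : O) (a b : A), act x (a * b) =
    LinearMap.mul' ℂ A (TensorProduct.map (act.toLinearMap.flip a) (act.toLinearMap.flip b)
      (comul (R := ℂ) x))
  act_one : ∀ x : O, act x 1 = counit (R := ℂ) x • (1 : A)
  act_star : ∀ (x : O) (a : A),
    act x (star a) = star (act (star (HopfAlgebra.antipode ℂ x)) a)

variable {O} in
/-- The linear map `x₁ ⊗ (x₂ ⊗ x₃) ↦ (y ⊗ a ↦ x₁ y S(x₃) ⊗ (x₂ ▹ a))`. -/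
def DualAction.twist {A : Type u} [CStarAlgebra A] (β : DualAction O A) :
    O ⊗[ℂ] (O ⊗[ℂ] O) →ₗ[ℂ] (O ⊗[ℂ] A →ₗ[ℂ] O ⊗[ℂ] A) :=
  TensorProduct.homTensorHomMap (RingHom.id ℂ) O A O A ∘ₗ
    (TensorProduct.comm ℂ (Module.End ℂ A) (Module.End ℂ O)).toLinearMap ∘ₗ
    TensorProduct.map β.act.toLinearMap
      (TensorProduct.lift ((LinearMap.mul ℂ (Module.End ℂ O)).compl₁₂ (LinearMap.mul ℂ O)
        ((LinearMap.mul ℂ O).flip ∘ₗ HopfAlgebra.antipode ℂ))) ∘ₗ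
    (TensorProduct.leftComm ℂ O O O).toLinearMap

variable {O} in
theorem DualAction.twist_tmul {A : Type u} [CStarAlgebra A] (β : DualAction O A)
    (x₁ x₂ x₃ y : O) (a : A) :
    β.twist (x₁ ⊗ₜ (x₂ ⊗ₜ x₃)) (y ⊗ₜ a)
      = (x₁ * (y * HopfAlgebra.antipode ℂ x₃)) ⊗ₜ[ℂ] β.act x₂ a := by
  simp [DualAction.twist]

/-- A Yetter–Drinfeld `G`-C⋆-algebra structure on a unital C⋆-algebra, that is, an action of the
Drinfeld double `D(G)`. -/
structure YDStructure (A : Type u) [CStarAlgebra A] extends QAction O A, DualAction O A where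
  /-- The Yetter–Drinfeld condition
  `α(x ▹ a) = x₍₁₎ a₍₁₎ S(x₍₃₎) ⊗ (x₍₂₎ ▹ a₍₂₎)` for `x ∈ ℂ[G]` and regular `a`. -/
  yetterDrinfeld : ∀ (x : O) (a : A) (t : O ⊗[ℂ] A), coact a = regularEmb O A t →
    coact (act x a) =
      regularEmb O A (toDualAction.twist ((comul (R := ℂ)).lTensor O (comul (R := ℂ) x)) t)

end Actions

/-! ### Unital completely positive and completely isometric maps -/

section UCP

attribute [local instance] CStarAlgebra.spectralOrder CStarAlgebra.spectralOrderedRing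

variable {A B : Type u} [CStarAlgebra A] [CStarAlgebra B]

/-- Unital completely positive maps. -/
def IsUCP (φ : A →ₗ[ℂ] B) : Prop :=
  φ 1 = 1 ∧ ∃ ψ : CompletelyPositiveMap A B, ψ.toLinearMap = φ

/-- Completely isometric maps. -/
def IsCompletelyIsometric (φ : A →ₗ[ℂ] B) : Prop :=
  ∀ (n : ℕ) (M : CStarMatrix (Fin n) (Fin n) A), ‖M.map φ‖ = ‖M‖

end UCP

/-! ### Equivariant maps, boundaries, injectivity -/

section Boundaries

variable {O : Type u} [Ring O] [StarRing O] [HopfAlgebra ℂ O] [StarModule ℂ O]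
  [CompactQuantumGroup O]

/-- `D(G)`-equivariance of a linear map `φ`: it satisfies `αφ = (ι ⊗ φ)α` on regular elements
(`G`-equivariance) and is a `ℂ[G]`-module map (equivariance for the dual of `G`). -/
structure IsEquivariant {A B : Type u} [CStarAlgebra A] [CStarAlgebra B]
    (X : YDStructure O A) (Y : YDStructure O B) (φ : A →ₗ[ℂ] B) : Prop where
  coact : ∀ (a : A) (t : O ⊗[ℂ] A), X.coact a = regularEmb O A t →
    Y.coact (φ a) = regularEmb O B (φ.lTensor O t)
  act : ∀ (x : O) (a : A), φ (X.act x a) = Y.act x (φ a)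

variable (O) in
/-- A (nonzero) unital Yetter–Drinfeld `G`-C⋆-algebra. -/
structure YDAlgebra : Type (u + 1) where
  carrier : Type u
  [cstarAlgebra : CStarAlgebra carrier]
  [nontrivial : Nontrivial carrier]
  str : YDStructure O carrier

attribute [instance] YDAlgebra.cstarAlgebra YDAlgebra.nontrivial

instance : CoeSort (YDAlgebra O) (Type u) := ⟨YDAlgebra.carrier⟩

/-- `D(G)`-equivariant ucp maps between unital Yetter–Drinfeld `G`-C⋆-algebras. -/
def IsEquivariantUCP (A B : YDAlgebra O) (φ : A →ₗ[ℂ] B) : Prop :=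
  IsUCP φ ∧ IsEquivariant A.str B.str φ

/-- Isomorphism of Yetter–Drinfeld `G`-C⋆-algebras: a `D(G)`-equivariant `⋆`-isomorphism. -/
def YDAlgebra.IsIsomorphic (A B : YDAlgebra O) : Prop :=
  ∃ e : A ≃⋆ₐ[ℂ] B, IsEquivariant A.str B.str
    { toFun := e, map_add' := map_add e, map_smul' := map_smul e }

/-- `D(G)`-boundaries: every `D(G)`-equivariant ucp map out of `A` is completely isometric. -/
def IsBoundary (A : YDAlgebra O) : Prop :=
  ∀ (B : YDAlgebra O) (ψ : A →ₗ[ℂ] B), IsEquivariantUCP A B ψ → IsCompletelyIsometric ψ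

/-- `D(G)`-injectivity. -/
def IsDGInjective (A : YDAlgebra O) : Prop :=
  ∀ (B C : YDAlgebra O) (φ : B →ₗ[ℂ] C) (ψ : B →ₗ[ℂ] A),
    IsEquivariantUCP B C φ → IsCompletelyIsometric φ → IsEquivariantUCP B A ψ →
      ∃ ψ' : C →ₗ[ℂ] A, IsEquivariantUCP C A ψ' ∧ ψ' ∘ₗ φ = ψ

/-- Furstenberg–Hamana boundaries of `D(G)`: the `D(G)`-injective `D(G)`-boundaries. -/
def IsFurstenbergHamanaBoundary (F : YDAlgebra O) : Prop :=
  IsBoundary F ∧ IsDGInjective F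

/-- A unital Yetter–Drinfeld `G`-C⋆-subalgebra of `F`: a norm closed unital `⋆`-subalgebra which is
itself a Yetter–Drinfeld `G`-C⋆-algebra for the restrictions of the two actions on `F`; the last
condition says that the inclusion map is equivariant. -/
structure YDSubalgebra (F : YDAlgebra O) where
  toStarSubalgebra : StarSubalgebra ℂ F
  isClosed : IsClosed (toStarSubalgebra : Set F)
  str : YDStructure O toStarSubalgebra
  equivariant : IsEquivariant str F.str toStarSubalgebra.subtype.toAlgHom.toLinearMap

/-- The subalgebra as a Yetter–Drinfeld `G`-C⋆-algebra. -/
def YDSubalgebra.toYDAlgebra {F : YDAlgebra O} (S : YDSubalgebra F) : YDAlgebra O :=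
  haveI := S.isClosed
  { carrier := S.toStarSubalgebra
    str := S.str }

/-- The inclusion map between two subalgebras. -/
def YDSubalgebra.inclusion {F : YDAlgebra O} {S T : YDSubalgebra F}
    (h : S.toStarSubalgebra ≤ T.toStarSubalgebra) : S.toYDAlgebra →ₗ[ℂ] T.toYDAlgebra :=
  (StarSubalgebra.inclusion h).toAlgHom.toLinearMap

end Boundaries
end

/-! Rigidity comes first (`IsBoundary.eq_id`). If `φ` is an equivariant ucp self-map of a boundary,
its Cesàro means are equivariant and ucp, hence isometric. The mean of `1, φ, …, φⁿ` sends `x - φ x`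
to `(x - φⁿ⁺¹ x)/(n+1)`, of norm at most `2‖x‖/(n+1)`, so `φ x = x`. If `S ⊂ F` is a subalgebra,
injectivity extends an equivariant ucp map `S → F` to `F → F`, and rigidity makes the extension the
identity: the inclusion is the only such map (`IsFurstenbergHamanaBoundary.eq_incl`). A map `S₁ →
S₂`, followed by the inclusion into `F`, is therefore the inclusion of `S₁`; this settles uniqueness
and nonexistence.

The scalars embed in every algebra, so injectivity also yields an equivariant ucp map from any `B`
to `F` (`IsDGInjective.exists_map`). Hence every map `S → B` becomes the inclusion of `S` after
composition with a ucp map, and must be completely isometric: subalgebras of `F` are boundaries.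

Conversely, a boundary `A` has a completely isometric map `ψ : A → F`, not multiplicative a priori.
The C⋆-algebra generated by `ψ(A)` is a Yetter–Drinfeld subalgebra and carries a `⋆`-homomorphism
`π` onto `A` with `πψ = ι` (`IsCompletelyIsometric.exists_leftInverse`). This `π` is equivariant;
its domain is a boundary, so `π` is injective and an isomorphism.

The analytic core is `HilbertRep.exists_extension`: along a completely isometric ucp map `ψ : A →
B`, every representation `σ` of `A` sits inside some `τ ∘ ψ`, with `τ` a representation of `B`. It
follows from a Riesz extension of positive functionals and the Schwarz inequality. It produces `π`,
and also shows that `ι ⊗ φ` is isometric on minimal tensor products for injective `φ`, which is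
needed to restrict coactions to subalgebras. -/

noncomputable section

/-! ### Order and norm in C⋆-algebras -/

section Order

theorem CStarAlgebra.coe_smul_one_eq_algebraMap {D : Type*} [CStarAlgebra D] (r : ℝ) :
    (r : ℂ) • (1 : D) = algebraMap ℝ D r := by
  rw [Algebra.algebraMap_eq_smul_one, Complex.coe_smul]

variable {D E : Type*} [CStarAlgebra D] [PartialOrder D] [StarOrderedRing D]
  [CStarAlgebra E] [PartialOrder E] [StarOrderedRing E]

theorem CStarAlgebra.star_mul_self_le_smul_one (x : D) :
    star x * x ≤ ((‖x‖ ^ 2 : ℝ) : ℂ) • (1 : D) := by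
  rw [coe_smul_one_eq_algebraMap]
  exact CStarAlgebra.star_mul_le_algebraMap_norm_sq

theorem CStarAlgebra.norm_le_of_star_mul_self_le {b : D} {r : ℝ} (hr : 0 ≤ r)
    (h : star b * b ≤ ((r ^ 2 : ℝ) : ℂ) • (1 : D)) : ‖b‖ ≤ r := by
  rw [coe_smul_one_eq_algebraMap] at h
  have h1 : ‖star b * b‖ ≤ r ^ 2 :=
    (CStarAlgebra.norm_le_iff_le_algebraMap _ (by positivity) (star_mul_self_nonneg b)).2 h
  rw [CStarRing.norm_star_mul_self, ← sq] at h1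
  exact le_of_sq_le_sq h1 hr

theorem CStarAlgebra.exists_eq_star_mul_self {z : D} (h : 0 ≤ z) : ∃ b, z = star b * b :=
  CStarAlgebra.nonneg_iff_eq_star_mul_self.1 h

/-- A self-adjoint `z` with `‖z‖ ≤ t` is positive exactly when `‖t·1 - z‖ ≤ t`. Positivity is thus
visible in norms alone, which is how an isometry comes to reflect it. -/
theorem CStarAlgebra.nonneg_of_norm_eq {x : D} {y : E} (hx : IsSelfAdjoint x) (hy : 0 ≤ y)
    (h : ‖y‖ = ‖x‖) (h' : ‖((‖x‖ : ℝ) : ℂ) • (1 : D) - x‖ = ‖((‖x‖ : ℝ) : ℂ) • (1 : E) - y‖) :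
    0 ≤ x := by
  rw [coe_smul_one_eq_algebraMap, coe_smul_one_eq_algebraMap] at h'
  rw [nonneg_iff_isSelfAdjoint_and_quasispectrumRestricts] at hy ⊢
  refine ⟨hx, (SpectrumRestricts.nnreal_iff_nnnorm hx le_rfl).2 ?_⟩
  have h2 := (SpectrumRestricts.nnreal_iff_nnnorm (t := ‖x‖₊) hy.1 h.le).1 hy.2
  exact le_trans (NNReal.coe_le_coe.1 (by simpa using h'.le)) h2

end Order

/-! ### Positive matrices over a C⋆-algebra -/

section MatrixPositivity

attribute [local instance] CStarAlgebra.spectralOrder CStarAlgebra.spectralOrderedRing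

open CStarMatrix

/-- The matrix with entries `f i j`. -/
def CStarMatrix.ofFun {A m n : Type*} (f : m → n → A) : CStarMatrix m n A :=
  ofMatrix (Matrix.of f)

theorem CStarMatrix.ofFun_apply {A m n : Type*} (f : m → n → A) (i : m) (j : n) :
    ofFun f i j = f i j := rfl

variable {A : Type*} [CStarAlgebra A]

/-- The positive matrix `(rᵢ⋆ rⱼ)` defined by a row `r`. -/
def CStarMatrix.gram {n : Type*} (r : n → A) : CStarMatrix n n A :=
  ofFun fun i j => star (r i) * r j

theorem CStarMatrix.gram_apply {n : Type*} (r : n → A) (i j : n) :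
    gram r i j = star (r i) * r j := rfl

/-- Placing the row `r` in one row of an otherwise zero square matrix `N` writes the Gram matrix as
`N⋆N`. -/
theorem CStarMatrix.gram_nonneg {n : Type*} [Fintype n] (r : n → A) : 0 ≤ gram r := by
  classical
  rcases isEmpty_or_nonempty n with h | ⟨⟨i₀⟩⟩
  · exact le_of_eq (CStarMatrix.ext fun i => isEmptyElim i)
  · have h : gram r = star (ofFun fun i j => if i = i₀ then r j else 0 : CStarMatrix n n A) *
        ofFun fun i j => if i = i₀ then r j else 0 := by
      ext i j
      rw [mul_apply, Finset.sum_eq_single i₀ (fun k _ hk => ?_) (by simp)]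
      · simp [star_apply, ofFun_apply, gram_apply]
      · simp [ofFun_apply, hk]
    rw [h]
    exact star_mul_self_nonneg _

theorem CStarMatrix.sum_apply {m n ι : Type*} (s : Finset ι) (f : ι → CStarMatrix m n A)
    (i : m) (j : n) : (∑ l ∈ s, f l) i j = ∑ l ∈ s, f l i j := by
  classical
  induction s using Finset.induction_on with
  | empty => simp
  | insert a s ha ih => simp [Finset.sum_insert ha, ih]

/-- For rectangular `W` the product is the sum of the Gram matrices of the rows of `W`. -/
theorem CStarMatrix.conjTranspose_mul_self_nonneg {m n : Type*} [Fintype m] [Fintype n]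
    (W : CStarMatrix m n A) : 0 ≤ W.conjTranspose * W := by
  have h : W.conjTranspose * W = ∑ l, gram (W l) := by
    ext i j
    simp [CStarMatrix.sum_apply, mul_apply, gram_apply]
  rw [h]
  exact Finset.sum_nonneg fun l _ => gram_nonneg _

theorem CStarMatrix.exists_eq_star_mul_self {n : Type*} [Fintype n]
    {Z : CStarMatrix n n A} (hZ : 0 ≤ Z) : ∃ N : CStarMatrix n n A, Z = star N * N := by
  classical
  exact CStarAlgebra.exists_eq_star_mul_self (D := CStarMatrix n n A) hZ

theorem CStarMatrix.apply_self_nonneg {n : Type*} [Fintype n]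
    {Z : CStarMatrix n n A} (hZ : 0 ≤ Z) (i : n) : 0 ≤ Z i i := by
  obtain ⟨N, rfl⟩ := exists_eq_star_mul_self hZ
  rw [mul_apply]
  exact Finset.sum_nonneg fun k _ => star_mul_self_nonneg (N k i)

/-- With `Z = N⋆N` the matrix is `Y⋆ZY = (NY)⋆(NY)`, where `Y` may be rectangular. -/
theorem CStarMatrix.conj_nonneg {m n : Type*} [Fintype m] [Fintype n]
    {Z : CStarMatrix m m A} (hZ : 0 ≤ Z) (Y : CStarMatrix m n A) :
    0 ≤ (ofFun fun i j => ∑ k, ∑ l, star (Y k i) * Z k l * Y l j : CStarMatrix n n A) := by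
  obtain ⟨N, rfl⟩ := exists_eq_star_mul_self hZ
  convert conjTranspose_mul_self_nonneg (N * Y) using 1
  ext i j
  simp only [ofFun_apply, mul_apply, conjTranspose_apply, star_sum, star_mul, star_apply,
    Finset.mul_sum, Finset.sum_mul, mul_assoc]
  rw [Finset.sum_congr rfl fun k _ => Finset.sum_comm, Finset.sum_comm]
  exact Finset.sum_congr rfl fun k _ => Finset.sum_comm

end MatrixPositivity

/-! ### Schwarz inequality, contractivity and complete order embeddings -/

section UCP

attribute [local instance] CStarAlgebra.spectralOrder CStarAlgebra.spectralOrderedRing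

open CStarMatrix

variable {A B C : Type u} [CStarAlgebra A] [CStarAlgebra B] [CStarAlgebra C]

theorem isUCP_iff {φ : A →ₗ[ℂ] B} : IsUCP φ ↔ φ 1 = 1 ∧
    ∀ (k : ℕ) (M : CStarMatrix (Fin k) (Fin k) A), 0 ≤ M → 0 ≤ M.map φ := by
  refine and_congr_right fun _ => ⟨?_, fun h => ⟨⟨φ, h⟩, rfl⟩⟩
  rintro ⟨ψ, rfl⟩
  exact ψ.map_cstarMatrix_nonneg'

theorem IsUCP.map_nonneg_matrix {φ : A →ₗ[ℂ] B} (h : IsUCP φ) {n : Type*} [Fintype n]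
    {M : CStarMatrix n n A} (hM : 0 ≤ M) : 0 ≤ M.map φ := by
  obtain ⟨-, ψ, rfl⟩ := h
  exact ψ.map_cstarMatrix_nonneg M hM

theorem IsUCP.map_nonneg {φ : A →ₗ[ℂ] B} (h : IsUCP φ) {a : A} (ha : 0 ≤ a) : 0 ≤ φ a := by
  obtain ⟨-, ψ, rfl⟩ := h
  exact _root_.map_nonneg ψ ha

/-- The image of the positive matrix `[[1, a], [a⋆, a⋆a]]` is positive, hence hermitian; its
off-diagonal entries give the claim. -/
theorem IsUCP.map_star {φ : A →ₗ[ℂ] B} (h : IsUCP φ) (a : A) : φ (star a) = star (φ a) := by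
  have h1 := h.map_nonneg_matrix (gram_nonneg (n := Fin 2) ![1, a])
  have h2 := congrArg (fun M => M 1 0) (IsSelfAdjoint.of_nonneg h1).star_eq
  simpa [star_apply, gram_apply] using h2.symm

theorem IsUCP.comp {ψ : B →ₗ[ℂ] C} {φ : A →ₗ[ℂ] B} (hψ : IsUCP ψ) (hφ : IsUCP φ) :
    IsUCP (ψ ∘ₗ φ) :=
  isUCP_iff.2 ⟨by simp [hφ.1, hψ.1], fun k M hM =>
    (isUCP_iff.1 hψ).2 k _ ((isUCP_iff.1 hφ).2 k M hM)⟩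

theorem IsUCP.of_starAlgHom (φ : A →⋆ₐ[ℂ] B) : IsUCP φ.toAlgHom.toLinearMap :=
  isUCP_iff.2 ⟨map_one φ, fun k M hM =>
    CompletelyPositiveMapClass.map_cstarMatrix_nonneg' φ k M hM⟩

theorem IsCompletelyIsometric.of_starAlgHom (φ : A →⋆ₐ[ℂ] B) (h : Function.Injective φ) :
    IsCompletelyIsometric φ.toAlgHom.toLinearMap := fun n M =>
  NonUnitalStarAlgHom.norm_map (mapₙₐ (n := Fin n) (φ : A →⋆ₙₐ[ℂ] B))
    (map_injective h) M

theorem IsUCP.map_one_matrix {φ : A →ₗ[ℂ] B} (h : IsUCP φ) {n : Type*} [DecidableEq n] :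
    (1 : CStarMatrix n n A).map φ = 1 := by
  ext i j
  simp only [map_apply, one_apply]
  split_ifs
  · exact h.1
  · exact map_zero φ

theorem IsUCP.map_smul_one_sub_matrix {φ : A →ₗ[ℂ] B} (h : IsUCP φ) {n : Type*}
    [DecidableEq n] (c : ℂ) (M : CStarMatrix n n A) :
    (c • (1 : CStarMatrix n n A) - M).map φ = c • (1 : CStarMatrix n n B) - M.map φ := by
  rw [← h.map_one_matrix]
  ext i j
  simp

/-- The Kadison–Schwarz inequality for matrices. -/
theorem IsUCP.schwarz_matrix {φ : A →ₗ[ℂ] B} (h : IsUCP φ) {n : Type*} [Fintype n]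
    (M : CStarMatrix n n A) : star (M.map φ) * M.map φ ≤ (star M * M).map φ := by
  classical
  -- Take the block row `X = (1 | M)`, so that `φ(X⋆X)` has blocks `1`, `φ(M)`, `φ(M)⋆`, `φ(M⋆M)`.
  -- Compressing it by the block column `Y` with entries `-φ(M)` and `1` leaves `φ(M⋆M) -
  -- φ(M)⋆φ(M)`.
  let X : CStarMatrix n (n ⊕ n) A := ofFun fun i => Sum.elim (fun j => if i = j then 1 else 0) (M i)
  let Y : CStarMatrix (n ⊕ n) n B :=
    ofFun (Sum.elim (fun i j => -φ (M i j)) (fun i j => if i = j then 1 else 0))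
  have hZ := h.map_nonneg_matrix (conjTranspose_mul_self_nonneg X)
  have hY := conj_nonneg hZ Y
  rw [← sub_nonneg]
  convert hY using 1
  ext i j
  have e1 : ∀ k l, ((X.conjTranspose * X).map φ) (.inl k) (.inl l)
      = if k = l then 1 else 0 := fun k l => by
    rw [← h.1, ← map_zero φ, ← apply_ite φ]
    simp [X, mul_apply, ofFun_apply, apply_ite star, -map_sum, eq_comm]
  have e2 : ∀ k l, ((X.conjTranspose * X).map φ) (.inl k) (.inr l) = φ (M k l) := fun k l => by
    simp [X, mul_apply, ofFun_apply, apply_ite star, -map_sum]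
  have e3 : ∀ k l, ((X.conjTranspose * X).map φ) (.inr k) (.inl l) = star (φ (M l k)) :=
    fun k l => by
      simp [X, mul_apply, ofFun_apply, h.map_star, -map_sum]
  have e4 : ∀ k l, ((X.conjTranspose * X).map φ) (.inr k) (.inr l)
      = φ ((star M * M) k l) := fun k l => by
    simp [X, mul_apply, ofFun_apply, star_apply]
  rw [ofFun_apply]
  simp only [Fintype.sum_sum_type, e1, e2, e3, e4]
  simp only [Y, ofFun_apply, Sum.elim_inl, Sum.elim_inr]
  simp [apply_ite star, mul_apply, star_apply, sub_eq_neg_add, Finset.sum_add_distrib]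

/-- Schwarz and unitality give `φ(M)⋆φ(M) ≤ φ(M⋆M) ≤ ‖M‖²·1`. -/
theorem IsUCP.norm_matrix_le {φ : A →ₗ[ℂ] B} (h : IsUCP φ) {n : Type*} [Fintype n]
    (M : CStarMatrix n n A) : ‖M.map φ‖ ≤ ‖M‖ := by
  classical
  refine CStarAlgebra.norm_le_of_star_mul_self_le (D := CStarMatrix n n B) (norm_nonneg _)
    ((h.schwarz_matrix M).trans ?_)
  have h1 := CStarAlgebra.star_mul_self_le_smul_one (D := CStarMatrix n n A) M
  have h2 := h.map_nonneg_matrix (sub_nonneg.2 h1)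
  rw [← sub_nonneg]
  exact h2.trans_eq (h.map_smul_one_sub_matrix _ _)

theorem IsUCP.schwarz {φ : A →ₗ[ℂ] B} (h : IsUCP φ) (a : A) :
    star (φ a) * φ a ≤ φ (star a * a) := by
  have := h.schwarz_matrix (n := Fin 1) (ofFun fun _ _ => a)
  have h2 := apply_self_nonneg (sub_nonneg.2 this) 0
  rw [← sub_nonneg]
  simpa [mul_apply, star_apply, ofFun_apply] using h2

theorem IsUCP.norm_le {φ : A →ₗ[ℂ] B} (h : IsUCP φ) (a : A) : ‖φ a‖ ≤ ‖a‖ := by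
  refine CStarAlgebra.norm_le_of_star_mul_self_le (norm_nonneg _) ((h.schwarz a).trans ?_)
  have h2 := h.map_nonneg (sub_nonneg.2 (CStarAlgebra.star_mul_self_le_smul_one a))
  rwa [map_sub, sub_nonneg, map_smul, h.1] at h2

theorem IsUCP.continuous {φ : A →ₗ[ℂ] B} (h : IsUCP φ) : Continuous φ :=
  AddMonoidHomClass.continuous_of_bound φ 1 fun a => by simpa using h.norm_le a

theorem CStarMatrix.norm_oneByOne (a : A) :
    ‖(ofFun fun _ _ => a : CStarMatrix (Fin 1) (Fin 1) A)‖ = ‖a‖ := by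
  let f : A →⋆ₙₐ[ℂ] CStarMatrix (Fin 1) (Fin 1) A :=
    { toFun := fun a => ofFun fun _ _ => a
      map_smul' := fun _ _ => rfl
      map_zero' := rfl
      map_add' := fun _ _ => rfl
      map_mul' := fun a b => by ext; simp [mul_apply, ofFun_apply]
      map_star' := fun a => by ext; simp [star_apply, ofFun_apply] }
  exact NonUnitalStarAlgHom.norm_map f (fun a b h => congrArg (fun M => M 0 0) h) a

theorem IsCompletelyIsometric.norm_map {φ : A →ₗ[ℂ] B} (h : IsCompletelyIsometric φ) (a : A) :
    ‖φ a‖ = ‖a‖ := by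
  rw [← norm_oneByOne, ← norm_oneByOne a]
  exact h 1 (ofFun fun _ _ => a)

theorem IsCompletelyIsometric.injective {φ : A →ₗ[ℂ] B} (h : IsCompletelyIsometric φ) :
    Function.Injective φ := by
  rw [injective_iff_map_eq_zero]
  intro a ha
  rw [← norm_eq_zero, ← h.norm_map, ha, norm_zero]

/-- Both maps contract matrix norms, so `‖M‖ = ‖ψφ(M)‖ ≤ ‖φ(M)‖ ≤ ‖M‖`. -/
theorem IsCompletelyIsometric.of_comp {ψ : B →ₗ[ℂ] C} {φ : A →ₗ[ℂ] B} (hψ : IsUCP ψ)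
    (hφ : IsUCP φ) (h : IsCompletelyIsometric (ψ ∘ₗ φ)) : IsCompletelyIsometric φ := fun n M =>
  le_antisymm (hφ.norm_matrix_le M) ((h n M).symm.le.trans (hψ.norm_matrix_le (M.map φ)))

/-- A completely isometric ucp map is a complete order embedding. -/
theorem IsCompletelyIsometric.nonneg_of_map_nonneg {φ : A →ₗ[ℂ] B} (h : IsCompletelyIsometric φ)
    (hφ : IsUCP φ) {n : ℕ} {M : CStarMatrix (Fin n) (Fin n) A} (hM : 0 ≤ M.map φ) : 0 ≤ M := by
  -- Self-adjointness is reflected by injectivity; only then does the norm criterion for positivity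
  -- apply.
  have hsa : IsSelfAdjoint M := by
    refine map_injective h.injective ?_
    refine Eq.trans ?_ (IsSelfAdjoint.of_nonneg hM)
    ext i j
    simp [star_apply, hφ.map_star]
  refine CStarAlgebra.nonneg_of_norm_eq (D := CStarMatrix (Fin n) (Fin n) A)
    (E := CStarMatrix (Fin n) (Fin n) B) hsa hM (h n M) ((h n _).symm.trans ?_)
  exact congrArg norm (hφ.map_smul_one_sub_matrix _ _)

theorem CStarMatrix.reindex_nonneg {m n : Type*} [Fintype m] [Fintype n] (e : m ≃ n)
    {Z : CStarMatrix n n A} (hZ : 0 ≤ Z) : 0 ≤ (ofFun fun i j => Z (e i) (e j)) := by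
  obtain ⟨N, rfl⟩ := exists_eq_star_mul_self hZ
  convert star_mul_self_nonneg (ofFun fun i j => N (e i) (e j) : CStarMatrix m m A) using 1
  ext i j
  simp only [ofFun_apply, mul_apply, star_apply]
  exact (e.sum_comp fun k => star (N k (e i)) * N k (e j)).symm

theorem IsCompletelyIsometric.nonneg_of_map_nonneg_fintype {φ : A →ₗ[ℂ] B}
    (h : IsCompletelyIsometric φ) (hφ : IsUCP φ) {n : Type*} [Fintype n] {M : CStarMatrix n n A}
    (hM : 0 ≤ M.map φ) : 0 ≤ M := by
  let e := (Fintype.equivFin n).symm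
  have h1 := h.nonneg_of_map_nonneg hφ (M := ofFun fun i j => M (e i) (e j)) (reindex_nonneg e hM)
  convert reindex_nonneg e.symm h1 using 1
  ext i j
  simp [ofFun_apply]

/-- A convex combination of two ucp maps is ucp. -/
theorem IsUCP.convex {φ ψ : A →ₗ[ℂ] B} (hφ : IsUCP φ) (hψ : IsUCP ψ) {s t : ℝ} (hs : 0 ≤ s)
    (ht : 0 ≤ t) (hst : s + t = 1) : IsUCP ((s : ℂ) • φ + (t : ℂ) • ψ) := by
  refine isUCP_iff.2 ⟨?_, fun k M hM => ?_⟩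
  · simp only [LinearMap.add_apply, LinearMap.smul_apply, hφ.1, hψ.1, ← add_smul]
    rw [← Complex.ofReal_add, hst, Complex.ofReal_one, one_smul]
  · have h1 := (isUCP_iff.1 hφ).2 k M hM
    have h2 := (isUCP_iff.1 hψ).2 k M hM
    have h3 : M.map ((s : ℂ) • φ + (t : ℂ) • ψ) = s • M.map φ + t • M.map ψ := by
      ext i j
      simp
    rw [h3]
    exact add_nonneg (smul_nonneg hs h1) (smul_nonneg ht h2)

end UCP

/-! ### Extension of representations along complete order embeddings -/

section Kernel

variable {K B : Type u} [CStarAlgebra B]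

/-- The finitely supported matrix `(f(k)⋆ g(l))`. -/
def Finsupp.outer (f g : K →₀ B) : K × K →₀ B := by
  classical
  exact Finsupp.onFinset (f.support ×ˢ g.support) (fun p => star (f p.1) * g p.2) fun p hp => by
    simp only [Finset.mem_product, Finsupp.mem_support_iff]
    exact ⟨fun h => hp (by simp [h]), fun h => hp (by simp [h])⟩

theorem Finsupp.outer_apply (f g : K →₀ B) (p : K × K) :
    f.outer g p = star (f p.1) * g p.2 := rfl

/-- Left multiplication of a finitely supported function by `b`. -/
def Finsupp.leftMul (b : B) : (K →₀ B) →ₗ[ℂ] (K →₀ B) :=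
  Finsupp.mapRange.linearMap (LinearMap.mulLeft ℂ b)

theorem Finsupp.leftMul_apply (b : B) (f : K →₀ B) (k : K) : Finsupp.leftMul b f k = b * f k := rfl

variable (K B) in
/-- A positive functional on the finitely supported matrices over `B`. -/
structure PositiveKernel where
  toLinearMap : (K × K →₀ B) →ₗ[ℂ] ℂ
  re_nonneg : ∀ f : K →₀ B, 0 ≤ (toLinearMap (f.outer f)).re
  conj_symm : ∀ f g : K →₀ B, star (toLinearMap (g.outer f)) = toLinearMap (f.outer g)

namespace PositiveKernel

variable (G : PositiveKernel K B)

/-- The pre-Hilbert space of a positive kernel. -/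
@[nolint unusedArguments]
def Pre (_ : PositiveKernel K B) : Type u := K →₀ B

instance : AddCommGroup G.Pre := inferInstanceAs (AddCommGroup (K →₀ B))
instance : Module ℂ G.Pre := inferInstanceAs (Module ℂ (K →₀ B))

/-- The identity map. -/
def toPre : (K →₀ B) ≃ₗ[ℂ] G.Pre := LinearEquiv.refl ℂ _

/-- The inner product `⟨f, g⟩ = G(f⋆ g)`. -/
abbrev core : PreInnerProductSpace.Core ℂ G.Pre where
  inner f g := G.toLinearMap ((G.toPre.symm f).outer (G.toPre.symm g))
  conj_inner_symm f g := G.conj_symm _ _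
  re_inner_nonneg f := G.re_nonneg _
  add_left f g h := by
    rw [← map_add]
    congr 1
    ext p
    simp [Finsupp.outer_apply, add_mul]
  smul_left f g c := by
    rw [← Complex.star_def, ← smul_eq_mul, ← map_smul]
    congr 1
    ext p
    simp [Finsupp.outer_apply]

instance : SeminormedAddCommGroup G.Pre :=
  InnerProductSpace.Core.toSeminormedAddCommGroup (c := G.core)
instance : InnerProductSpace ℂ G.Pre := InnerProductSpace.ofCore G.core

theorem inner_toPre (f g : K →₀ B) : ⟪G.toPre f, G.toPre g⟫_ℂ = G.toLinearMap (f.outer g) := rfl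

/-- Write `‖b‖²·1 - b⋆b = c⋆c`. Then `‖b‖²⟨f, f⟩ - ⟨bf, bf⟩ = ⟨cf, cf⟩ ≥ 0`. -/
theorem norm_leftMul_le (b : B) (f : K →₀ B) :
    ‖G.toPre (Finsupp.leftMul b f)‖ ≤ ‖b‖ * ‖G.toPre f‖ := by
  let _ := CStarAlgebra.spectralOrder B
  have := CStarAlgebra.spectralOrderedRing B
  obtain ⟨c, hc⟩ := CStarAlgebra.exists_eq_star_mul_self
    (sub_nonneg.2 (CStarAlgebra.star_mul_self_le_smul_one b))
  have h1 : ((‖b‖ ^ 2 : ℝ) : ℂ) • f.outer f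
      - (Finsupp.leftMul b f).outer (Finsupp.leftMul b f)
      = (Finsupp.leftMul c f).outer (Finsupp.leftMul c f) := by
    ext p
    simp only [Finsupp.sub_apply, Finsupp.smul_apply, Finsupp.outer_apply, Finsupp.leftMul_apply,
      star_mul]
    rw [mul_assoc _ (star c), ← mul_assoc (star c), ← hc]
    simp [mul_assoc, sub_mul, mul_sub]
  have h2 := congrArg (fun m => (G.toLinearMap m).re) h1
  simp only [map_sub, map_smul, Complex.sub_re, smul_eq_mul, Complex.re_ofReal_mul] at h2
  have h3 := G.re_nonneg (Finsupp.leftMul c f)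
  rw [← h2, sub_nonneg] at h3
  refine le_of_sq_le_sq ?_ (by positivity)
  rw [mul_pow, ← inner_self_eq_norm_sq (𝕜 := ℂ), ← inner_self_eq_norm_sq (𝕜 := ℂ) (G.toPre f),
    inner_toPre, inner_toPre]
  exact h3

/-- Left multiplication by `b` on the pre-Hilbert space. -/
def leftMulPre (b : B) : G.Pre →L[ℂ] G.Pre :=
  (G.toPre.toLinearMap ∘ₗ Finsupp.leftMul b ∘ₗ G.toPre.symm.toLinearMap).mkContinuous ‖b‖
    fun f => G.norm_leftMul_le b (G.toPre.symm f)

theorem leftMulPre_apply (b : B) (f : K →₀ B) :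
    G.leftMulPre b (G.toPre f) = G.toPre (Finsupp.leftMul b f) := rfl

/-- The representation defined by a positive kernel. -/
def rep : HilbertRep B where
  space := UniformSpace.Completion G.Pre
  hom :=
  { toFun := fun b => (G.leftMulPre b).completion
    map_one' := by
      ext z
      refine UniformSpace.Completion.induction_on z
        (isClosed_eq (by fun_prop) (by fun_prop)) fun y => ?_
      obtain ⟨y, rfl⟩ := G.toPre.surjective y
      have : Finsupp.leftMul (1 : B) y = y := by ext; simp [Finsupp.leftMul_apply]
      simp [leftMulPre_apply, this]
    map_mul' := fun a b => by
      ext z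
      refine UniformSpace.Completion.induction_on z
        (isClosed_eq (by fun_prop) (by fun_prop)) fun y => ?_
      obtain ⟨y, rfl⟩ := G.toPre.surjective y
      have : Finsupp.leftMul (a * b) y = Finsupp.leftMul a (Finsupp.leftMul b y) := by
        ext; simp [Finsupp.leftMul_apply, mul_assoc]
      simp [leftMulPre_apply, this]
    map_zero' := by
      ext z
      refine UniformSpace.Completion.induction_on z
        (isClosed_eq (by fun_prop) (by fun_prop)) fun y => ?_
      obtain ⟨y, rfl⟩ := G.toPre.surjective y
      have : Finsupp.leftMul (0 : B) y = 0 := by ext; simp [Finsupp.leftMul_apply]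
      simp only [ContinuousLinearMap.completion_apply_coe, leftMulPre_apply, this, map_zero]
      exact UniformSpace.Completion.coe_zero
    map_add' := fun a b => by
      ext z
      refine UniformSpace.Completion.induction_on z
        (isClosed_eq (by fun_prop) (by fun_prop)) fun y => ?_
      obtain ⟨y, rfl⟩ := G.toPre.surjective y
      have : Finsupp.leftMul (a + b) y = Finsupp.leftMul a y + Finsupp.leftMul b y := by
        ext; simp [Finsupp.leftMul_apply, add_mul]
      simp [leftMulPre_apply, this, UniformSpace.Completion.coe_add]
    commutes' := fun c => by
      ext z
      refine UniformSpace.Completion.induction_on z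
        (isClosed_eq (by fun_prop) (by fun_prop)) fun y => ?_
      obtain ⟨y, rfl⟩ := G.toPre.surjective y
      have : Finsupp.leftMul (algebraMap ℂ B c) y = c • y := by
        ext; simp [Finsupp.leftMul_apply, Algebra.algebraMap_eq_smul_one]
      rw [ContinuousLinearMap.completion_apply_coe, leftMulPre_apply, this, map_smul,
        UniformSpace.Completion.coe_smul, Algebra.algebraMap_eq_smul_one]
      rfl
    map_star' := fun a => by
      rw [ContinuousLinearMap.star_eq_adjoint, ContinuousLinearMap.eq_adjoint_iff]
      intro z w
      refine UniformSpace.Completion.induction_on₂ z w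
        (isClosed_eq (by fun_prop) (by fun_prop)) fun x y => ?_
      obtain ⟨x, rfl⟩ := G.toPre.surjective x
      obtain ⟨y, rfl⟩ := G.toPre.surjective y
      have : (Finsupp.leftMul (star a) x).outer y = x.outer (Finsupp.leftMul a y) := by
        ext; simp [Finsupp.leftMul_apply, Finsupp.outer_apply, mul_assoc]
      simp [leftMulPre_apply, inner_toPre, this] }

/-- The vector `1` at `k`. -/
def vec (k : K) : G.rep.space :=
  ((G.toPre (Finsupp.single k 1) : G.Pre) : UniformSpace.Completion G.Pre)

theorem inner_vec_hom_vec (k l : K) (b : B) :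
    ⟪G.vec k, G.rep.hom b (G.vec l)⟫_ℂ = G.toLinearMap (Finsupp.single (k, l) b) := by
  have h1 : G.rep.hom b (G.vec l) = ((G.toPre (Finsupp.leftMul b (Finsupp.single l 1)) : G.Pre) :
      UniformSpace.Completion G.Pre) :=
    ContinuousLinearMap.completion_apply_coe (G.leftMulPre b) _
  have h2 : (Finsupp.single k (1 : B)).outer (Finsupp.leftMul b (Finsupp.single l 1))
      = Finsupp.single (k, l) b := by
    classical
    ext p
    simp only [Finsupp.outer_apply, Finsupp.leftMul_apply, Finsupp.single_apply, Prod.ext_iff]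
    by_cases h : k = p.1 <;> by_cases h' : l = p.2 <;> simp [h, h']
  rw [h1, ← h2]
  exact UniformSpace.Completion.inner_coe _ _

end PositiveKernel

/-- A map between Hilbert spaces which preserves inner products is a linear isometry. -/
theorem exists_linearIsometry_of_inner {H H' : Type*} [NormedAddCommGroup H]
    [InnerProductSpace ℂ H] [NormedAddCommGroup H'] [InnerProductSpace ℂ H'] (V : H → H')
    (h : ∀ x y, ⟪V x, V y⟫_ℂ = ⟪x, y⟫_ℂ) : ∃ W : H →ₗᵢ[ℂ] H', ∀ x, W x = V x := by
  let W : H →ₗ[ℂ] H' :=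
    { toFun := V
      map_add' := fun x y => by
        -- The square norm of the defect of additivity expands into inner products of values of `V`,
        -- which are those of the arguments and cancel. Homogeneity is the same.
        rw [← sub_eq_zero, ← inner_self_eq_zero (𝕜 := ℂ)]
        simp only [inner_sub_left, inner_sub_right, inner_add_left, inner_add_right, h]
        ring
      map_smul' := fun c x => by
        rw [← sub_eq_zero, ← inner_self_eq_zero (𝕜 := ℂ)]
        simp only [inner_sub_left, inner_sub_right, inner_smul_left, inner_smul_right, h,
          RingHom.id_apply]
        ring }
  exact ⟨W.isometryOfInner h, fun x => rfl⟩

end Kernel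

/-! ### Riesz extension of the kernel of a representation -/

section Extension

attribute [local instance] CStarAlgebra.spectralOrder CStarAlgebra.spectralOrderedRing

open CStarMatrix

variable {K A B : Type u} [CStarAlgebra A] [CStarAlgebra B]

/-- The restriction of `m + m⋆` to a finite set of indices. -/
def Finsupp.hermMatrix (m : K × K →₀ B) (T : Finset K) : CStarMatrix T T B :=
  ofFun fun i j => m (i, j) + star (m (j, i))

variable (K B) in
/-- The matrices with positive real part. -/
def accretiveCone : PointedCone ℝ (K × K →₀ B) where
  carrier := {m | ∀ T, 0 ≤ m.hermMatrix T}
  zero_mem' T := le_of_eq (by ext i j; simp [Finsupp.hermMatrix, ofFun_apply])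
  add_mem' {m n} hm hn T := by
    refine (add_nonneg (hm T) (hn T)).trans_eq ?_
    ext i j
    simp only [Finsupp.hermMatrix, ofFun_apply, CStarMatrix.add_apply, Finsupp.add_apply, star_add]
    abel
  smul_mem' c m hm T := by
    classical
    refine (smul_nonneg c.2 (hm T)).trans_eq ?_
    ext i j
    simp only [Finsupp.hermMatrix, ofFun_apply, CStarMatrix.smul_apply, Finsupp.smul_apply, smul_add]
    exact congrArg _ (star_smul (c : ℝ) (m (j, i))).symm

/-- Together with their negatives, these matrices lie in the cone, so a functional nonnegative on
the cone kills them. This is what makes the extended kernel hermitian. -/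
theorem mem_accretiveCone_of_antiherm {m : K × K →₀ B} (h : ∀ k l, m (k, l) + star (m (l, k)) = 0) :
    m ∈ accretiveCone K B := fun T => le_of_eq (by
  ext i j; simp [Finsupp.hermMatrix, ofFun_apply, h])

theorem outer_self_mem_accretiveCone (f : K →₀ B) : f.outer f ∈ accretiveCone K B := fun T => by
  refine (add_nonneg (gram_nonneg fun i : T => f i) (gram_nonneg fun i : T => f i)).trans_eq ?_
  ext i j
  simp [Finsupp.hermMatrix, ofFun_apply, gram_apply, Finsupp.outer_apply]

/-- Entrywise computation for `exists_add_single_mem_accretiveCone`: the left side is an entry of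
the sum of the Gram matrices of the rows `e_k + b e_l` and `c e_l`. The propositions encode which
indices equal `k` or `l`, and `k = l` is allowed. -/
theorem star_ite_add_mul_ite_add {x y b c : B} (h1 : x + star x = 1)
    (h2 : y + star y = star b * b + star c * c) (p q r s : Prop) [Decidable p] [Decidable q]
    [Decidable r] [Decidable s] :
    star ((if p then 1 else 0) + (if r then b else 0)) *
        ((if q then 1 else 0) + (if s then b else 0)) +
      star (if r then c else 0) * (if s then c else 0)
    = (if p ∧ q then x else 0) + (if r ∧ s then y else 0) + (if p ∧ s then b else 0) +
      star ((if q ∧ p then x else 0) + (if s ∧ r then y else 0) + (if q ∧ r then b else 0)) := by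
  by_cases hp : p <;> by_cases hq : q <;> by_cases hr : r <;> by_cases hs : s <;>
    simp [hp, hq, hr, hs, add_mul, mul_add] <;> grind

/-- This is the cofinality hypothesis of the Riesz extension: a single entry `b` is dominated by
scalar diagonal entries, which lie in the image of any unital map. Completing the square with `c⋆c =
‖b‖²·1 - b⋆b` gives the positive matrix. -/
theorem exists_add_single_mem_accretiveCone (k l : K) (b : B) : ∃ s t : ℝ,
    Finsupp.single (k, k) ((s : ℂ) • 1) + Finsupp.single (l, l) ((t : ℂ) • 1)
      + Finsupp.single (k, l) b ∈ accretiveCone K B := by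
  classical
  obtain ⟨c, hc⟩ := CStarAlgebra.exists_eq_star_mul_self
    (sub_nonneg.2 (CStarAlgebra.star_mul_self_le_smul_one b))
  -- The halves are there because the cone tests `m + m⋆`, which doubles the diagonal.
  refine ⟨1 / 2, ‖b‖ ^ 2 / 2, fun T => ?_⟩
  refine (add_nonneg (gram_nonneg fun i : T => (if k = i then 1 else 0) + (if l = i then b else 0))
    (gram_nonneg fun i : T => if l = i then c else 0)).trans_eq ?_
  have h2 : ∀ x : ℝ, ((x / 2 : ℝ) : ℂ) • (1 : B) + star (((x / 2 : ℝ) : ℂ) • (1 : B))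
      = (x : ℂ) • 1 := fun x => by
    rw [star_smul, star_one, ← add_smul]
    congr 1
    simp
  have h1 := h2 1
  rw [Complex.ofReal_one, one_smul] at h1
  ext i j
  simp only [Finsupp.hermMatrix, ofFun_apply, gram_apply, Finsupp.add_apply, Finsupp.single_apply,
    CStarMatrix.add_apply, Prod.mk.injEq]
  exact star_ite_add_mul_ite_add h1 ((h2 _).trans (by rw [← hc, add_sub_cancel])) _ _ _ _

/-- The functional `m ↦ ∑ ⟨k, σ(m(k, l)) l⟩`. -/
def HilbertRep.kernel (σ : HilbertRep A) : (σ.space × σ.space →₀ A) →ₗ[ℂ] ℂ :=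
  Finsupp.lsum ℂ fun p => (innerSL ℂ p.1).toLinearMap ∘ₗ
    (ContinuousLinearMap.apply ℂ σ.space p.2).toLinearMap ∘ₗ σ.hom.toAlgHom.toLinearMap

theorem HilbertRep.kernel_single (σ : HilbertRep A) (k l : σ.space) (a : A) :
    σ.kernel (Finsupp.single (k, l) a) = ⟪k, σ.hom a l⟫_ℂ := by
  simp [HilbertRep.kernel]

theorem HilbertRep.kernel_eq_sum (σ : HilbertRep A) (m : σ.space × σ.space →₀ A)
    (T : Finset σ.space) (hT : m.support ⊆ T ×ˢ T) :
    σ.kernel m = ∑ k ∈ T, ∑ l ∈ T, ⟪k, σ.hom (m (k, l)) l⟫_ℂ := by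
  rw [HilbertRep.kernel, Finsupp.lsum_apply, Finsupp.sum_of_support_subset _ hT _ (by simp),
    Finset.sum_product]
  rfl

/-- If `m + m⋆ = N⋆N` on a finite index set carrying `m`, then twice the real part is `∑ᵢ ‖∑ₖ
σ(Nᵢₖ)k‖²`. -/
theorem HilbertRep.re_kernel_nonneg (σ : HilbertRep A) {m : σ.space × σ.space →₀ A}
    (hm : m ∈ accretiveCone σ.space A) : 0 ≤ (σ.kernel m).re := by
  classical
  let T := m.support.image Prod.fst ∪ m.support.image Prod.snd
  have hT : m.support ⊆ T ×ˢ T := fun p hp => Finset.mem_product.2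
    ⟨Finset.mem_union_left _ (Finset.mem_image_of_mem _ hp),
      Finset.mem_union_right _ (Finset.mem_image_of_mem _ hp)⟩
  obtain ⟨N, hN⟩ := CStarMatrix.exists_eq_star_mul_self (hm T)
  have h1 : ∑ k : T, ∑ l : T, ⟪(k : σ.space), σ.hom (m.hermMatrix T k l) l⟫_ℂ
      = σ.kernel m + star (σ.kernel m) := by
    rw [σ.kernel_eq_sum m T hT]
    simp only [Finsupp.hermMatrix, ofFun_apply, map_add, _root_.add_apply, inner_add_right,
      Finset.sum_add_distrib, star_sum]
    congr 1
    · rw [← Finset.sum_coe_sort T]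
      exact Finset.sum_congr rfl fun k _ => Finset.sum_coe_sort T
        fun l => ⟪(k : σ.space), σ.hom (m (k, l)) l⟫_ℂ
    · rw [Finset.sum_comm, ← Finset.sum_coe_sort T]
      refine Finset.sum_congr rfl fun k _ => ?_
      rw [← Finset.sum_coe_sort T]
      refine Finset.sum_congr rfl fun l _ => ?_
      rw [map_star, ContinuousLinearMap.star_eq_adjoint, ContinuousLinearMap.adjoint_inner_right]
      exact (inner_conj_symm _ _).symm
  have h2 : ∑ k : T, ∑ l : T, ⟪(k : σ.space), σ.hom (m.hermMatrix T k l) l⟫_ℂ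
      = ∑ i : T, ⟪∑ k : T, σ.hom (N i k) (k : σ.space), ∑ l : T, σ.hom (N i l) (l : σ.space)⟫_ℂ := by
    simp only [hN, mul_apply, map_sum, sum_inner, inner_sum, star_apply, map_mul, map_star,
      _root_.sum_apply, ContinuousLinearMap.star_eq_adjoint, mul_apply_eq_comp, ContinuousLinearMap.adjoint_inner_right]
    rw [Finset.sum_congr rfl fun k _ => Finset.sum_comm, Finset.sum_comm]
    exact Finset.sum_congr rfl fun k _ => Finset.sum_comm
  have h3 := congrArg Complex.re (h1.symm.trans h2)
  rw [Complex.re_sum] at h3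
  have h4 : 0 ≤ (σ.kernel m + star (σ.kernel m)).re := by
    rw [h3]
    exact Finset.sum_nonneg fun i _ => inner_self_nonneg (𝕜 := ℂ)
  simp at h4
  exact h4

/-- The extension of the kernel of a representation along a complete order embedding. -/
theorem HilbertRep.exists_positiveKernel {ψ : A →ₗ[ℂ] B} (hψ : IsUCP ψ)
    (hi : IsCompletelyIsometric ψ) (σ : HilbertRep A) : ∃ G : PositiveKernel σ.space B,
      ∀ k l a, G.toLinearMap (Finsupp.single (k, l) (ψ a)) = ⟪k, σ.hom a l⟫_ℂ := by
  classical
  -- The Riesz extension is over `ℝ`: the functional to extend is the real part of `σ.kernel`,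
  -- carried to the matrices with entries in the range of `ψ`.
  let ι : (σ.space × σ.space →₀ A) →ₗ[ℝ] (σ.space × σ.space →₀ B) :=
    (Finsupp.mapRange.linearMap ψ).restrictScalars ℝ
  have hι : ∀ m p, ι m p = ψ (m p) := fun _ _ => rfl
  have hinj : Function.Injective ι := Finsupp.mapRange_injective ψ (map_zero ψ) hi.injective
  let e := LinearEquiv.ofInjective ι hinj
  let f : (σ.space × σ.space →₀ B) →ₗ.[ℝ] ℝ :=
    { domain := LinearMap.range ι
      toFun := Complex.reLm ∘ₗ σ.kernel.restrictScalars ℝ ∘ₗ e.symm.toLinearMap }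
  have hf : ∀ m (h : ι m ∈ f.domain), f ⟨ι m, h⟩ = (σ.kernel m).re := fun m h => by
    have : e.symm ⟨ι m, h⟩ = m := e.symm_apply_eq.2 rfl
    simp [f, this]
  -- Nonnegativity on the subspace holds because `ψ` reflects positivity of matrices; cofinality is
  -- checked on single entries, where the scalar diagonal comes from `A` since `ψ 1 = 1`.
  obtain ⟨g, hg, hpos⟩ := riesz_extension (accretiveCone σ.space B) f (by
    rintro ⟨_, m, rfl⟩ hm
    refine (hf m ⟨m, rfl⟩).symm.le.trans' ?_
    refine σ.re_kernel_nonneg fun T => hi.nonneg_of_map_nonneg_fintype hψ ((hm T).trans_eq ?_)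
    ext i j
    simp [Finsupp.hermMatrix, ofFun_apply, hι, hψ.map_star]) (by
    intro y
    induction y using Finsupp.induction_linear with
    | zero => exact ⟨0, by simp⟩
    | add y z hy hz =>
      obtain ⟨x, hx⟩ := hy
      obtain ⟨x', hx'⟩ := hz
      refine ⟨x + x', ?_⟩
      have := add_mem hx hx'
      rwa [add_add_add_comm, ← Submodule.coe_add] at this
    | single p b =>
      obtain ⟨s, t, h⟩ := exists_add_single_mem_accretiveCone p.1 p.2 b
      refine ⟨⟨ι (Finsupp.single (p.1, p.1) ((s : ℂ) • 1) +
        Finsupp.single (p.2, p.2) ((t : ℂ) • 1)), _, rfl⟩, ?_⟩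
      convert h using 2
      ext q
      simp only [hι, Finsupp.add_apply, Finsupp.single_apply, map_add, apply_ite ψ, map_smul,
        hψ.1, map_zero])
  have hzero : ∀ m : σ.space × σ.space →₀ B, (∀ k l, m (k, l) + star (m (l, k)) = 0) →
      g m = 0 := fun m hm => by
    refine le_antisymm ?_ (hpos m (mem_accretiveCone_of_antiherm hm))
    have := hpos (-m) (mem_accretiveCone_of_antiherm fun k l => by
      rw [Finsupp.neg_apply, Finsupp.neg_apply, star_neg, ← neg_add, hm, neg_zero])
    rw [map_neg] at this
    linarith
  -- The complex functional is `m ↦ g(m) - i g(im)`. Its hermitian symmetry uses that `f'⋆f - f⋆f'`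
  -- and `i(f'⋆f + f⋆f')` are antihermitian, hence killed by `g`.
  refine ⟨⟨Module.Dual.extendRCLike g, fun f => ?_, fun f f' => ?_⟩, fun k l a => ?_⟩
  · exact (hpos _ (outer_self_mem_accretiveCone f)).trans_eq
      (Module.Dual.re_extendRCLike_apply (𝕜 := ℂ) g _).symm
  · have h1 : g (f'.outer f) - g (f.outer f') = 0 := by
      rw [← map_sub]
      refine hzero _ fun k l => ?_
      simp [Finsupp.outer_apply]
    have h2 : g (Complex.I • f'.outer f) + g (Complex.I • f.outer f') = 0 := by
      rw [← map_add]
      refine hzero _ fun k l => ?_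
      simp [Finsupp.outer_apply]
    rw [Module.Dual.extendRCLike_apply, Module.Dual.extendRCLike_apply]
    apply Complex.ext
    · simp; linarith
    · simp; linarith
  · have h1 : ∀ c : ℂ, g (c • Finsupp.single (k, l) (ψ a)) = (c * ⟪k, σ.hom a l⟫_ℂ).re := fun c => by
      have h2 : c • Finsupp.single (k, l) (ψ a) = ι (Finsupp.single (k, l) (c • a)) := by
        simp [ι]
      rw [h2]
      refine (hg ⟨_, _, rfl⟩).trans ((hf _ ⟨_, rfl⟩).trans ?_)
      rw [kernel_single]
      simp
    have h2 := h1 1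
    rw [one_smul, one_mul] at h2
    rw [Module.Dual.extendRCLike_apply]
    apply Complex.ext
    · simp [h2]
    · simp [h1, -Finsupp.smul_single]

/-- Every representation of `A` is a subrepresentation of the restriction along a completely
isometric ucp map `ψ : A → B` of a representation of `B`. -/
theorem HilbertRep.exists_extension {ψ : A →ₗ[ℂ] B} (hψ : IsUCP ψ)
    (hi : IsCompletelyIsometric ψ) (σ : HilbertRep A) :
    ∃ (τ : HilbertRep B) (V : σ.space →ₗᵢ[ℂ] τ.space),
      ∀ a k, τ.hom (ψ a) (V k) = V (σ.hom a k) := by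
  obtain ⟨G, hG⟩ := σ.exists_positiveKernel hψ hi
  have h1 : ∀ k l a, ⟪G.vec k, G.rep.hom (ψ a) (G.vec l)⟫_ℂ = ⟪k, σ.hom a l⟫_ℂ := fun k l a => by
    rw [G.inner_vec_hom_vec, hG]
  obtain ⟨V, hV⟩ := exists_linearIsometry_of_inner G.vec fun k l => by
    simpa [hψ.1] using h1 k l 1
  refine ⟨G.rep, V, fun a k => ?_⟩
  simp only [← hV] at h1
  -- So far `σ(a)` is only the compression of `τ(ψ(a))` to the range of `V`. The Schwarz inequality
  -- for `ψ` gives `‖τ(ψ(a))Vk‖ ≤ ‖σ(a)k‖`.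
  obtain ⟨c, hc⟩ := CStarAlgebra.exists_eq_star_mul_self (sub_nonneg.2 (hψ.schwarz a))
  have hstar : ∀ b : B, ⟪V k, G.rep.hom (star b * b) (V k)⟫_ℂ
      = ((‖G.rep.hom b (V k)‖ ^ 2 : ℝ) : ℂ) := fun b => by
    rw [map_mul, map_star, ContinuousLinearMap.star_eq_adjoint, mul_apply_eq_comp,
      ContinuousLinearMap.adjoint_inner_right]
    simp
  have h2 : ‖G.rep.hom (ψ a) (V k)‖ ^ 2 ≤ ‖σ.hom a k‖ ^ 2 := by
    have h3 := hstar c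
    rw [← hc, map_sub, _root_.sub_apply, inner_sub_right, hstar, h1, map_mul,
      map_star, ContinuousLinearMap.star_eq_adjoint, mul_apply_eq_comp, ContinuousLinearMap.adjoint_inner_right,
      inner_self_eq_norm_sq_to_K] at h3
    have h4 : ‖σ.hom a k‖ ^ 2 - ‖G.rep.hom (ψ a) (V k)‖ ^ 2 = ‖G.rep.hom c (V k)‖ ^ 2 := by
      rw [← Complex.ofReal_inj, ← h3]
      simp
    nlinarith [sq_nonneg ‖G.rep.hom c (V k)‖]
  -- By the compression identity, `‖τ(ψ(a))Vk - Vσ(a)k‖² = ‖τ(ψ(a))Vk‖² - ‖σ(a)k‖²`, which is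
  -- nonpositive.
  rw [← sub_eq_zero, ← norm_eq_zero, ← sq_eq_zero_iff]
  refine le_antisymm ?_ (sq_nonneg _)
  rw [@norm_sub_sq ℂ, V.norm_map, ← inner_re_symm, h1, inner_self_eq_norm_sq]
  linarith

end Extension

/-! ### Representations determine the norm -/

section NormAttaining

variable {A : Type u} [CStarAlgebra A]

/-- The Gelfand transform is isometric, and a continuous function attains its maximum modulus on the
compact character space. -/
theorem CStarAlgebra.exists_character_norm_eq {C : Type*} [CommCStarAlgebra C] [Nontrivial C]
    (x : C) : ∃ χ : WeakDual.characterSpace ℂ C, ‖χ x‖ = ‖x‖ := by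
  have h : ‖WeakDual.gelfandTransform ℂ C x‖ = ‖x‖ :=
    (AddMonoidHomClass.isometry_iff_norm _).1 (gelfandTransform_isometry C) x
  obtain ⟨χ, -, hχ⟩ := isCompact_univ.exists_isMaxOn Set.univ_nonempty
    (WeakDual.gelfandTransform ℂ C x).continuous.norm.continuousOn
  refine ⟨χ, le_antisymm ?_ ?_⟩
  · rw [← h]
    exact (WeakDual.gelfandTransform ℂ C x).norm_coe_le_norm χ
  · rw [← h]
    exact (ContinuousMap.norm_le _ (norm_nonneg _)).2 fun χ' => hχ (Set.mem_univ χ')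

/-- The norm of a C⋆-algebra is determined by its representations. -/
theorem HilbertRep.norm_le_of_forall {a : A} {r : ℝ} (hr : 0 ≤ r)
    (h : ∀ τ : HilbertRep A, ‖τ.hom a‖ ≤ r) : ‖a‖ ≤ r := by
  rcases subsingleton_or_nontrivial A with hA | hA
  · rwa [Subsingleton.elim a 0, norm_zero]
  have hsn : IsStarNormal (star a * a) := (IsSelfAdjoint.star_mul_self a).isStarNormal
  -- A character of this commutative subalgebra attaining `‖a⋆a‖` is a one-dimensional
  -- representation. Extended to `A`, it contains a unit vector on which `a⋆a` acts with full norm.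
  let C := StarAlgebra.elemental ℂ (star a * a)
  let x : C := ⟨star a * a, StarAlgebra.elemental.self_mem ℂ _⟩
  obtain ⟨χ, hχ⟩ := CStarAlgebra.exists_character_norm_eq x
  let σ : HilbertRep C :=
    { space := EuclideanSpace ℂ PUnit.{u + 1}
      hom := (StarAlgHom.ofId ℂ _).comp (χ : C →⋆ₐ[ℂ] ℂ) }
  have hσ : ∀ v, σ.hom x v = χ x • v := fun v => rfl
  let v : σ.space := EuclideanSpace.single PUnit.unit (1 : ℂ)
  have hv : ‖v‖ = 1 := by simp [v, σ]
  obtain ⟨τ, V, hV⟩ := σ.exists_extension (IsUCP.of_starAlgHom C.subtype)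
    (IsCompletelyIsometric.of_starAlgHom C.subtype Subtype.val_injective)
  have h1 : ‖τ.hom (star a * a) (V v)‖ = ‖star a * a‖ := by
    have h2 : τ.hom (star a * a) (V v) = V (σ.hom x v) := hV x v
    rw [h2, V.norm_map, hσ, norm_smul, hv, mul_one, hχ]
    rfl
  have h3 : ‖star a * a‖ ≤ ‖τ.hom (star a * a)‖ := by
    rw [← h1]
    refine (ContinuousLinearMap.le_opNorm _ _).trans_eq ?_
    rw [V.norm_map, hv, mul_one]
  rw [map_mul, map_star, CStarRing.norm_star_mul_self, CStarRing.norm_star_mul_self] at h3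
  exact (abs_le_of_sq_le_sq' (by nlinarith) (norm_nonneg _)).2.trans (h τ)

end NormAttaining

/-! ### Functoriality and injectivity of the minimal tensor product -/

section MinTensorMap

variable {C A B : Type u} [CStarAlgebra C] [CStarAlgebra A] [CStarAlgebra B]

/-- The pullback of a representation. -/
def HilbertRep.comp (σ : HilbertRep B) (φ : A →⋆ₐ[ℂ] B) : HilbertRep A where
  space := σ.space
  hom := σ.hom.comp φ

theorem HilbertRep.tensor_comp (ρ : HilbertRep C) (σ : HilbertRep B) (φ : A →⋆ₐ[ℂ] B)
    (t : C ⊗[ℂ] A) : ρ.tensor (σ.comp φ) t = ρ.tensor σ (φ.toAlgHom.toLinearMap.lTensor C t) := by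
  induction t with
  | zero =>
    rw [map_zero, map_zero, map_zero]
    rfl
  | add s t hs ht =>
    rw [map_add, map_add, map_add, hs, ht]
    rfl
  | tmul c a =>
    rw [LinearMap.lTensor_tmul, HilbertRep.tensor_tmul, HilbertRep.tensor_tmul]
    rfl

theorem minNorm_lTensor_le (φ : A →⋆ₐ[ℂ] B) (t : C ⊗[ℂ] A) :
    minNorm (φ.toAlgHom.toLinearMap.lTensor C t) ≤ minNorm t :=
  Real.iSup_le (fun p => by
    rw [← HilbertRep.tensor_comp]
    exact norm_tensor_le_minNorm t (p.1, p.2.comp φ)) (minNorm_nonneg _)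

/-- The isometry `1 ⊗ V`. -/
def HilbertTensor.mapRightIsometry (H : Type u) {K L : Type u} [NormedAddCommGroup H]
    [InnerProductSpace ℂ H] [NormedAddCommGroup K] [InnerProductSpace ℂ K]
    [NormedAddCommGroup L] [InnerProductSpace ℂ L] (V : K →ₗᵢ[ℂ] L) :
    HilbertTensor H K →L[ℂ] HilbertTensor H L :=
  (V.lTensor H).toContinuousLinearMap.completion

theorem HilbertTensor.mapRightIsometry_tmul {H K L : Type u} [NormedAddCommGroup H]
    [InnerProductSpace ℂ H] [NormedAddCommGroup K] [InnerProductSpace ℂ K]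
    [NormedAddCommGroup L] [InnerProductSpace ℂ L] (V : K →ₗᵢ[ℂ] L) (x : H) (y : K) :
    mapRightIsometry H V (tmul x y) = tmul x (V y) :=
  ContinuousLinearMap.completion_apply_coe _ _

theorem HilbertTensor.norm_mapRightIsometry {H K L : Type u} [NormedAddCommGroup H]
    [InnerProductSpace ℂ H] [NormedAddCommGroup K] [InnerProductSpace ℂ K]
    [NormedAddCommGroup L] [InnerProductSpace ℂ L] (V : K →ₗᵢ[ℂ] L) (z : HilbertTensor H K) :
    ‖mapRightIsometry H V z‖ = ‖z‖ := by
  refine UniformSpace.Completion.induction_on z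
    (isClosed_eq (mapRightIsometry H V).continuous.norm continuous_norm) fun t => ?_
  refine (congrArg norm (ContinuousLinearMap.completion_apply_coe _ _)).trans ?_
  refine (UniformSpace.Completion.norm_coe _).trans ?_
  exact ((V.lTensor H).norm_map t).trans (UniformSpace.Completion.norm_coe _).symm

/-- Every representation `σ` of `A` is a subrepresentation of some `τ ∘ φ`, through an isometry `V`.
Then `1 ⊗ V` intertwines `ρ ⊗ σ` with `ρ ⊗ τ` after `ι ⊗ φ`, so no norm is lost. -/
theorem minNorm_lTensor_of_injective (φ : A →⋆ₐ[ℂ] B) (hφ : Function.Injective φ)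
    (t : C ⊗[ℂ] A) : minNorm (φ.toAlgHom.toLinearMap.lTensor C t) = minNorm t := by
  refine le_antisymm (minNorm_lTensor_le φ t) (Real.iSup_le (fun p => ?_) (minNorm_nonneg _))
  obtain ⟨ρ, σ⟩ := p
  obtain ⟨τ, V, hV⟩ := σ.exists_extension (IsUCP.of_starAlgHom φ)
    (IsCompletelyIsometric.of_starAlgHom φ hφ)
  let W := HilbertTensor.mapRightIsometry ρ.space V
  have hW : ∀ (t : C ⊗[ℂ] A) z, ρ.tensor τ (φ.toAlgHom.toLinearMap.lTensor C t) (W z)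
      = W (ρ.tensor σ t z) := fun t z => by
    induction t with
    | zero => simp
    | add s t hs ht => simp only [map_add, add_apply, hs, ht]
    | tmul c a =>
      rw [LinearMap.lTensor_tmul, HilbertRep.tensor_tmul, HilbertRep.tensor_tmul]
      refine HilbertTensor.induction (P := fun z => HilbertTensor.map (ρ.hom c)
        (τ.hom (φ a)) (W z) = W (HilbertTensor.map (ρ.hom c) (σ.hom a) z)) z
        (isClosed_eq (by fun_prop) (by fun_prop)) (fun x y => ?_) fun z z' hz hz' => ?_
      · have h := hV a y
        simp only [W, HilbertTensor.mapRightIsometry_tmul, HilbertTensor.map_tmul]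
        exact congrArg _ h
      · simp only [map_add, hz, hz']
  refine ContinuousLinearMap.opNorm_le_bound _ (minNorm_nonneg _) fun z => ?_
  rw [← HilbertTensor.norm_mapRightIsometry V, ← hW, ← HilbertTensor.norm_mapRightIsometry V z]
  refine (ContinuousLinearMap.le_opNorm _ _).trans ?_
  exact mul_le_mul_of_nonneg_right (norm_tensor_le_minNorm _ (ρ, τ)) (norm_nonneg _)

namespace MinTensor

variable (C) in
/-- The function underlying `ι ⊗ φ`. -/
def mapRightFun (φ : A →⋆ₐ[ℂ] B) : MinTensor C A → MinTensor C B :=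
  UniformSpace.Completion.extension
    fun t : PreMinTensor C A => of (φ.toAlgHom.toLinearMap.lTensor C (show C ⊗[ℂ] A from t))

theorem lipschitzWith_of_lTensor (φ : A →⋆ₐ[ℂ] B) : LipschitzWith 1
    fun t : PreMinTensor C A => of (φ.toAlgHom.toLinearMap.lTensor C (show C ⊗[ℂ] A from t)) := by
  refine LipschitzWith.of_dist_le_mul fun s t => ?_
  rw [NNReal.coe_one, one_mul, dist_eq_norm, dist_eq_norm]
  have h : of (φ.toAlgHom.toLinearMap.lTensor C (show C ⊗[ℂ] A from s))
      - of (φ.toAlgHom.toLinearMap.lTensor C (show C ⊗[ℂ] A from t))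
      = of (φ.toAlgHom.toLinearMap.lTensor C ((show C ⊗[ℂ] A from s) - (show C ⊗[ℂ] A from t))) := by
    rw [map_sub, sub_eq_iff_eq_add, ← of_add, sub_add_cancel]
  rw [h, norm_of]
  exact minNorm_lTensor_le φ _

theorem continuous_mapRightFun (φ : A →⋆ₐ[ℂ] B) : Continuous (mapRightFun C φ) :=
  UniformSpace.Completion.continuous_extension

theorem mapRightFun_of (φ : A →⋆ₐ[ℂ] B) (t : C ⊗[ℂ] A) :
    mapRightFun C φ (of t) = of (φ.toAlgHom.toLinearMap.lTensor C t) :=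
  UniformSpace.Completion.extension_coe (lipschitzWith_of_lTensor φ).uniformContinuous t

variable (C) in
/-- The `⋆`-homomorphism `ι ⊗ φ` of minimal tensor products. -/
def mapRight (φ : A →⋆ₐ[ℂ] B) : MinTensor C A →⋆ₐ[ℂ] MinTensor C B where
  toFun := mapRightFun C φ
  map_one' := by
    have h : (1 : MinTensor C A) = of 1 := rfl
    rw [h, mapRightFun_of, Algebra.TensorProduct.one_def, LinearMap.lTensor_tmul]
    simp
    rfl
  map_mul' x y := by
    refine MinTensor.induction (P := fun x => mapRightFun C φ (x * y)
      = mapRightFun C φ x * mapRightFun C φ y) x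
      (isClosed_eq ((continuous_mapRightFun φ).comp (continuous_id.mul continuous_const))
        ((continuous_mapRightFun φ).mul continuous_const)) fun s => ?_
    refine MinTensor.induction (P := fun y => mapRightFun C φ (of s * y)
      = mapRightFun C φ (of s) * mapRightFun C φ y) y
      (isClosed_eq ((continuous_mapRightFun φ).comp (continuous_const.mul continuous_id))
        (continuous_const.mul (continuous_mapRightFun φ))) fun t => ?_
    rw [← of_mul, mapRightFun_of, mapRightFun_of, mapRightFun_of, ← of_mul]
    congr 1
    exact map_mul (Algebra.TensorProduct.map (AlgHom.id ℂ C) φ.toAlgHom) s t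
  map_zero' := by
    have h : (0 : MinTensor C A) = of 0 := rfl
    rw [h, mapRightFun_of, map_zero]
    rfl
  map_add' x y := by
    refine MinTensor.induction (P := fun x => mapRightFun C φ (x + y)
      = mapRightFun C φ x + mapRightFun C φ y) x
      (isClosed_eq ((continuous_mapRightFun φ).comp (continuous_id.add continuous_const))
        ((continuous_mapRightFun φ).add continuous_const)) fun s => ?_
    refine MinTensor.induction (P := fun y => mapRightFun C φ (of s + y)
      = mapRightFun C φ (of s) + mapRightFun C φ y) y
      (isClosed_eq ((continuous_mapRightFun φ).comp (continuous_const.add continuous_id))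
        (continuous_const.add (continuous_mapRightFun φ))) fun t => ?_
    rw [← of_add, mapRightFun_of, mapRightFun_of, mapRightFun_of, ← of_add, map_add]
  commutes' c := by
    have h : (algebraMap ℂ (MinTensor C A) c) = of (c • 1) := by
      rw [of_smul, Algebra.algebraMap_eq_smul_one]
      rfl
    rw [h, mapRightFun_of, map_smul, of_smul, Algebra.TensorProduct.one_def,
      LinearMap.lTensor_tmul, Algebra.algebraMap_eq_smul_one]
    simp
    rfl
  map_star' x := by
    refine MinTensor.induction (P := fun x => mapRightFun C φ (star x)
      = star (mapRightFun C φ x)) x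
      (isClosed_eq ((continuous_mapRightFun φ).comp continuous_star)
        (continuous_star.comp (continuous_mapRightFun φ))) fun s => ?_
    rw [← of_star, mapRightFun_of, mapRightFun_of, ← of_star]
    congr 1
    induction s with
    | zero => simp
    | add s t hs ht => simp only [star_add, map_add, hs, ht]
    | tmul c a =>
      simp only [TensorProduct.star_tmul, LinearMap.lTensor_tmul]
      exact congrArg _ (map_star φ a)

theorem mapRight_of (φ : A →⋆ₐ[ℂ] B) (t : C ⊗[ℂ] A) :
    mapRight C φ (of t) = of (φ.toAlgHom.toLinearMap.lTensor C t) := mapRightFun_of φ t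

theorem continuous_mapRight (φ : A →⋆ₐ[ℂ] B) : Continuous (mapRight C φ) :=
  continuous_mapRightFun φ

theorem norm_mapRight_of_injective (φ : A →⋆ₐ[ℂ] B) (hφ : Function.Injective φ)
    (x : MinTensor C A) : ‖mapRight C φ x‖ = ‖x‖ := by
  refine MinTensor.induction (P := fun x => ‖mapRight C φ x‖ = ‖x‖) x
    (isClosed_eq (continuous_mapRight φ).norm continuous_norm) fun t => ?_
  rw [mapRight_of, norm_of, norm_of, minNorm_lTensor_of_injective φ hφ]

theorem mapRight_injective (φ : A →⋆ₐ[ℂ] B) (hφ : Function.Injective φ) :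
    Function.Injective (mapRight C φ) := by
  rw [injective_iff_map_eq_zero]
  intro x hx
  rw [← norm_eq_zero, ← norm_mapRight_of_injective φ hφ, hx, norm_zero]

end MinTensor

end MinTensorMap

/-! ### The algebraic tensor product inside the minimal one -/

section RegularEmb

variable {O : Type u} [Ring O] [StarRing O] [HopfAlgebra ℂ O] [StarModule ℂ O]
  [CompactQuantumGroup O] {A B : Type u} [CStarAlgebra A] [CStarAlgebra B]

theorem regularEmb_tmul (x : O) (a : A) :
    regularEmb O A (x ⊗ₜ a) = MinTensor.of (toReduced O x ⊗ₜ a) := by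
  simp [regularEmb]
  rfl

theorem mapRight_regularEmb (φ : A →⋆ₐ[ℂ] B) (t : O ⊗[ℂ] A) :
    MinTensor.mapRight (ReducedCStar O) φ (regularEmb O A t)
      = regularEmb O B (φ.toAlgHom.toLinearMap.lTensor O t) := by
  induction t with
  | zero => simp
  | add s t hs ht => simp only [map_add, hs, ht]
  | tmul x a =>
    rw [LinearMap.lTensor_tmul, regularEmb_tmul, regularEmb_tmul, MinTensor.mapRight_of,
      LinearMap.lTensor_tmul]

theorem regularEmb_star (t : O ⊗[ℂ] A) : regularEmb O A (star t) = star (regularEmb O A t) := by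
  induction t with
  | zero => simp
  | add s t hs ht => simp only [star_add, map_add, hs, ht]
  | tmul x a =>
    rw [TensorProduct.star_tmul, regularEmb_tmul, regularEmb_tmul, ← MinTensor.of_star,
      TensorProduct.star_tmul, map_star]

end RegularEmb

/-! ### Unitary corepresentations and continuity of the dual action -/

section Corep

open Coalgebra

/-- Every element of a coalgebra lies in a finite dimensional right subcomodule. -/
theorem Coalgebra.exists_finite_subcomodule {O : Type*} [AddCommGroup O] [Module ℂ O]
    [Coalgebra ℂ O] (x : O) : ∃ s : Finset O, x ∈ Submodule.span ℂ (s : Set O) ∧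
      ∀ y ∈ s, ∃ d : O → O, comul (R := ℂ) y = ∑ z ∈ s, z ⊗ₜ[ℂ] d z := by
  classical
  -- Expand `Δ(x) = ∑ cₖ ⊗ eₖ` in a basis of the second leg. The finitely many `cₖ` span the
  -- subcomodule: the counit puts `x` in the span, and comparing the coefficients of `eₖ` in the
  -- third leg of coassociativity computes `Δ(cₖ)`.
  let e := Module.Basis.ofVectorSpace ℂ O
  obtain ⟨c, hc⟩ := TensorProduct.eq_repr_basis_right e (comul (R := ℂ) x)
  have hx : x = ∑ k ∈ c.support, counit (R := ℂ) (e k) • c k := by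
    have h := congrArg (_root_.TensorProduct.rid ℂ O) (Coalgebra.lTensor_counit_comul (R := ℂ) x)
    rw [← hc] at h
    simpa [Finsupp.sum] using h.symm
  have hk : ∀ k, comul (R := ℂ) (c k) = ∑ l ∈ c.support, c l ⊗ₜ[ℂ]
      _root_.TensorProduct.rid ℂ O ((e.coord k).lTensor O (comul (R := ℂ) (e l))) := by
    intro k
    have h := Coalgebra.coassoc_apply (R := ℂ) x
    have h2 := congrArg (fun t => (_root_.TensorProduct.rid ℂ O).toLinearMap.lTensor O
      (((e.coord k).lTensor O).lTensor O t)) h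
    rw [← hc] at h2
    simp only [Finsupp.sum, map_sum, LinearMap.rTensor_tmul, LinearMap.lTensor_tmul] at h2
    rw [← LinearEquiv.coe_coe] at h2
    have h3 : ∀ (t : O ⊗[ℂ] O) (z : O), (_root_.TensorProduct.rid ℂ O).toLinearMap.lTensor O
        (((e.coord k).lTensor O).lTensor O (_root_.TensorProduct.assoc ℂ O O O (t ⊗ₜ z)))
        = e.coord k z • t := by
      intro t z
      induction t with
      | zero => simp
      | add s t hs ht => rw [TensorProduct.add_tmul, map_add, map_add, map_add, hs, ht, smul_add]
      | tmul a b => simp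
    simp only [LinearEquiv.coe_coe, h3] at h2
    simp only [Module.Basis.coord_apply, Module.Basis.repr_self, Finsupp.single_apply, ite_smul,
      one_smul, zero_smul, Finset.sum_ite_eq', Finsupp.mem_support_iff] at h2
    rw [← h2]
    split_ifs with h0
    · rfl
    · rw [not_not.1 h0, map_zero]
  refine ⟨c.support.image c, ?_, ?_⟩
  · rw [hx]
    refine Submodule.sum_mem _ fun k hk => Submodule.smul_mem _ _ (Submodule.subset_span ?_)
    exact Finset.mem_coe.2 (Finset.mem_image_of_mem _ hk)
  · intro y hy
    obtain ⟨k, -, rfl⟩ := Finset.mem_image.1 hy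
    -- Distinct indices may give the same `c l`, so the coefficient of `z` collects a whole fibre.
    refine ⟨fun z => ∑ l ∈ c.support with c l = z,
      _root_.TensorProduct.rid ℂ O ((e.coord k).lTensor O (comul (R := ℂ) (e l))), ?_⟩
    rw [hk k, ← Finset.sum_fiberwise_of_maps_to (g := c) (t := c.support.image c)
      fun l hl => Finset.mem_image_of_mem _ hl]
    refine Finset.sum_congr rfl fun z _ => ?_
    rw [TensorProduct.tmul_sum]
    refine Finset.sum_congr rfl fun l hl => ?_
    rw [(Finset.mem_filter.1 hl).2]

open CompactQuantumGroup

variable {O : Type u} [Ring O] [StarRing O] [HopfAlgebra ℂ O] [StarModule ℂ O]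
  [CompactQuantumGroup O]

/-- A finite dimensional subcomodule of `ℂ[G]` has an orthonormal basis. -/
theorem CompactQuantumGroup.exists_orthonormal_corep (x : O) :
    ∃ (n : ℕ) (v : Fin n → O) (u : Fin n → Fin n → O),
      (∀ i j, haar (star (v i) * v j) = if i = j then 1 else 0) ∧
      (∀ j, comul (R := ℂ) (v j) = ∑ i, v i ⊗ₜ[ℂ] u i j) ∧ x ∈ Submodule.span ℂ (Set.range v) := by
  classical
  obtain ⟨s, hx, hs⟩ := Coalgebra.exists_finite_subcomodule x
  -- Passing to the Haar inner product lets an orthonormal basis be chosen; this choice makes the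
  -- matrix coefficients unitary.
  let S : Submodule ℂ (PreL2 O) := (Submodule.span ℂ (s : Set O)).map (toPreL2 O).toLinearMap
  have : FiniteDimensional ℂ (Submodule.span ℂ (s : Set O)) :=
    FiniteDimensional.span_finset ℂ s
  have : FiniteDimensional ℂ S := inferInstance
  let e := stdOrthonormalBasis ℂ S
  let v : Fin (Module.finrank ℂ S) → O := fun i => (toPreL2 O).symm (e i : PreL2 O)
  have horth : ∀ i j, haar (star (v i) * v j) = if i = j then 1 else 0 := by
    intro i j
    have h := orthonormal_iff_ite.1 e.orthonormal i j
    rw [← h]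
    rfl
  have hspan : ∀ y ∈ Submodule.span ℂ (s : Set O), y ∈ Submodule.span ℂ (Set.range v) := by
    intro y hy
    let y' : S := ⟨toPreL2 O y, Submodule.mem_map_of_mem hy⟩
    have h1 := congrArg (fun z : S => (toPreL2 O).symm (z : PreL2 O)) (e.sum_repr y')
    simp only [Submodule.coe_sum, Submodule.coe_smul, map_sum, map_smul] at h1
    have h2 : y = ∑ i, (e.repr y') i • v i := h1.symm
    rw [h2]
    exact Submodule.sum_mem _ fun i _ => Submodule.smul_mem _ _ (Submodule.subset_span ⟨i, rfl⟩)
  have hv : ∀ j, v j ∈ Submodule.span ℂ (s : Set O) := by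
    intro j
    obtain ⟨y, hy, h⟩ := (e j).2
    have : v j = y := by
      simp only [v]
      rw [← h]
      rfl
    rwa [this]
  have hcomul : ∀ y ∈ Submodule.span ℂ (s : Set O), ∃ d : Fin (Module.finrank ℂ S) → O,
      comul (R := ℂ) y = ∑ i, v i ⊗ₜ[ℂ] d i := by
    have hz : ∀ z ∈ Submodule.span ℂ (Set.range v), ∀ w : O,
        ∃ d : Fin (Module.finrank ℂ S) → O, z ⊗ₜ[ℂ] w = ∑ i, v i ⊗ₜ[ℂ] d i := by
      intro z hz w
      obtain ⟨c, rfl⟩ := (Submodule.mem_span_range_iff_exists_fun ℂ).1 hz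
      refine ⟨fun i => c i • w, ?_⟩
      rw [TensorProduct.sum_tmul]
      exact Finset.sum_congr rfl fun i _ => TensorProduct.smul_tmul _ _ _
    intro y hy
    induction hy using Submodule.span_induction with
    | mem y hy =>
      obtain ⟨d, hd⟩ := hs y hy
      choose d' hd' using fun z : s => hz z (hspan z (Submodule.subset_span z.2)) (d z)
      refine ⟨fun i => ∑ z, d' z i, ?_⟩
      rw [hd, ← Finset.sum_coe_sort s, Finset.sum_congr rfl fun z _ => hd' z, Finset.sum_comm]
      simp [TensorProduct.tmul_sum]
    | zero => exact ⟨0, by simp⟩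
    | add y z _ _ hy hz =>
      obtain ⟨d, hd⟩ := hy
      obtain ⟨d', hd'⟩ := hz
      exact ⟨d + d', by simp [hd, hd', TensorProduct.tmul_add, Finset.sum_add_distrib]⟩
    | smul c y _ hy =>
      obtain ⟨d, hd⟩ := hy
      exact ⟨c • d, by simp [hd, Finset.smul_sum]⟩
  choose d hd using fun j => hcomul (v j) (hv j)
  exact ⟨_, v, fun i j => d j i, horth, hd, hspan x hx⟩

/-- Every regular function is a linear combination of matrix coefficients of a finite dimensional
unitary corepresentation. -/
theorem CompactQuantumGroup.exists_unitary_corep (x : O) :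
    ∃ (n : ℕ) (u : Fin n → Fin n → O),
      (∀ i j, comul (R := ℂ) (u i j) = ∑ k, u i k ⊗ₜ[ℂ] u k j) ∧
      (∀ i j, star (HopfAlgebra.antipode ℂ (u i j)) = u j i) ∧
      x ∈ Submodule.span ℂ (Set.range fun p : Fin n × Fin n => u p.1 p.2) := by
  classical
  obtain ⟨n, v, u, horth, hv, hx⟩ := exists_orthonormal_corep x
  -- By orthonormality, these functionals are dual to `v`; they isolate `u i j` in the identities
  -- for `v j`.
  let f : Fin n → O →ₗ[ℂ] ℂ := fun i => haar ∘ₗ LinearMap.mulLeft ℂ (star (v i))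
  have hf : ∀ i j, f i (v j) = if i = j then 1 else 0 := horth
  have hu : ∀ i j, comul (R := ℂ) (u i j) = ∑ k, u i k ⊗ₜ[ℂ] u k j := by
    intro i j
    have h := Coalgebra.coassoc_apply (R := ℂ) (v j)
    have h2 := congrArg (fun t => TensorProduct.lid ℂ (O ⊗[ℂ] O) ((f i).rTensor (O ⊗[ℂ] O) t)) h
    simp only [hv, map_sum, LinearMap.rTensor_tmul, LinearMap.lTensor_tmul,
      TensorProduct.sum_tmul, TensorProduct.assoc_tmul, TensorProduct.lid_tmul, hf] at h2
    simpa using h2.symm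
  have hcounit : ∀ i j, counit (R := ℂ) (u i j) = if i = j then 1 else 0 := by
    intro i j
    have h := congrArg (fun t => f i (TensorProduct.rid ℂ O t))
      (Coalgebra.lTensor_counit_comul (R := ℂ) (v j))
    simpa [hv, hf] using h
  -- Invariance of the Haar state, applied to `vᵢ⋆vⱼ`, says that `u⋆u = 1`.
  have hiso : ∀ i j, ∑ k, star (u k i) * u k j = if i = j then 1 else 0 := by
    intro i j
    have h := haar_left (star (v i) * v j)
    rw [Bialgebra.comul_mul, comul_star, hv, hv] at h
    simp only [star_sum, TensorProduct.star_tmul, Finset.sum_mul_sum,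
      Algebra.TensorProduct.tmul_mul_tmul, map_sum, LinearMap.rTensor_tmul,
      TensorProduct.lid_tmul, horth, ite_smul, one_smul, zero_smul] at h
    simpa using h
  have hanti : ∀ i j, ∑ k, u i k * HopfAlgebra.antipode ℂ (u k j) = if i = j then 1 else 0 := by
    intro i j
    have h := HopfAlgebra.mul_antipode_lTensor_comul_apply (R := ℂ) (u i j)
    rw [hu, hcounit] at h
    simp only [map_sum, LinearMap.lTensor_tmul, LinearMap.mul'_apply] at h
    rw [h]
    split_ifs <;> simp
  refine ⟨n, u, hu, fun i j => ?_, ?_⟩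
  · have h : HopfAlgebra.antipode ℂ (u i j) = star (u j i) := by
      calc HopfAlgebra.antipode ℂ (u i j)
          = ∑ l, (∑ k, star (u k i) * u k l) * HopfAlgebra.antipode ℂ (u l j) := by
            simp [hiso]
        _ = ∑ k, star (u k i) * ∑ l, u k l * HopfAlgebra.antipode ℂ (u l j) := by
            simp only [Finset.sum_mul, Finset.mul_sum, mul_assoc]
            exact Finset.sum_comm
        _ = star (u j i) := by simp [hanti]
    rw [h, star_star]
  · refine Submodule.span_le.2 ?_ hx
    rintro _ ⟨j, rfl⟩
    have h := congrArg (TensorProduct.lid ℂ O) (Coalgebra.rTensor_counit_comul (R := ℂ) (v j))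
    rw [hv] at h
    simp only [map_sum, LinearMap.rTensor_tmul, TensorProduct.lid_tmul, one_smul] at h
    rw [← h]
    exact Submodule.sum_mem _ fun i _ => Submodule.smul_mem _ _ (Submodule.subset_span ⟨(i, j), rfl⟩)

end Corep

section DualActionContinuity

attribute [local instance] CStarAlgebra.spectralOrder CStarAlgebra.spectralOrderedRing

variable {O : Type u} [Ring O] [StarRing O] [HopfAlgebra ℂ O] [StarModule ℂ O]
  [CompactQuantumGroup O] {A : Type u} [CStarAlgebra A]

/-- For a unitary corepresentation `u`, the map `a ↦ (uᵢⱼ ▹ a)` is a `⋆`-homomorphism into matrices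
over `A`: multiplicative by the formula for `Δ(uᵢⱼ)`, `⋆`-preserving by unitarity. It is therefore
contractive, and such coefficients span `ℂ[G]`. -/
theorem DualAction.continuous_act (β : DualAction O A) (x : O) : Continuous (β.act x) := by
  obtain ⟨n, u, hu, hstar, hx⟩ := CompactQuantumGroup.exists_unitary_corep x
  let Θ : A →⋆ₙₐ[ℂ] CStarMatrix (Fin n) (Fin n) A :=
    { toFun := fun a => CStarMatrix.ofFun fun i j => β.act (u i j) a
      map_smul' := fun c a => by ext i j; simp [CStarMatrix.ofFun_apply]
      map_zero' := by ext i j; simp [CStarMatrix.ofFun_apply]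
      map_add' := fun a b => by ext i j; simp [CStarMatrix.ofFun_apply]
      map_mul' := fun a b => by
        ext i j
        simp [CStarMatrix.ofFun_apply, CStarMatrix.mul_apply, β.act_mul, hu]
      map_star' := fun a => by
        ext i j
        simp only [CStarMatrix.ofFun_apply, CStarMatrix.star_apply, β.act_star, hstar] }
  have hb : ∀ i j a, ‖β.act (u i j) a‖ ≤ ‖a‖ := fun i j a =>
    (CStarMatrix.norm_entry_le_norm (M := Θ a) (i := i) (j := j)).trans
      (NonUnitalStarAlgHom.norm_apply_le Θ a)
  induction hx using Submodule.span_induction with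
  | mem y hy =>
    obtain ⟨p, rfl⟩ := hy
    exact AddMonoidHomClass.continuous_of_bound (β.act (u p.1 p.2)) 1 fun a => by
      simpa using hb p.1 p.2 a
  | zero =>
    rw [map_zero]
    exact continuous_const
  | add y z _ _ hy hz =>
    rw [map_add]
    exact hy.add hz
  | smul c y _ hy =>
    rw [map_smul]
    exact hy.const_smul c

end DualActionContinuity

/-! ### Equivariant maps and rigidity of boundaries -/

section Equivariance

variable {O : Type u} [Ring O] [StarRing O] [HopfAlgebra ℂ O] [StarModule ℂ O]
  [CompactQuantumGroup O] {A B C : Type u} [CStarAlgebra A] [CStarAlgebra B] [CStarAlgebra C]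
  {X : YDStructure O A} {Y : YDStructure O B} {Z : YDStructure O C}

theorem IsEquivariant.id : IsEquivariant X X LinearMap.id where
  coact a t h := by rw [LinearMap.lTensor_id]; exact h
  act x a := rfl

theorem IsEquivariant.comp {ψ : B →ₗ[ℂ] C} {φ : A →ₗ[ℂ] B} (hψ : IsEquivariant Y Z ψ)
    (hφ : IsEquivariant X Y φ) : IsEquivariant X Z (ψ ∘ₗ φ) where
  coact a t h := by
    rw [LinearMap.lTensor_comp]
    exact hψ.coact _ _ (hφ.coact a t h)
  act x a := by simp [hφ.act, hψ.act]

theorem IsEquivariant.linearCombination {φ ψ : A →ₗ[ℂ] B} (hφ : IsEquivariant X Y φ)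
    (hψ : IsEquivariant X Y ψ) (c d : ℂ) : IsEquivariant X Y (c • φ + d • ψ) where
  coact a t h := by
    rw [LinearMap.lTensor_add, LinearMap.lTensor_smul, LinearMap.lTensor_smul]
    simp only [LinearMap.add_apply, LinearMap.smul_apply, map_add, map_smul, hφ.coact a t h,
      hψ.coact a t h]
  act x a := by simp [hφ.act, hψ.act]

theorem IsEquivariant.of_starAlgHom (φ : A →⋆ₐ[ℂ] B)
    (hcoact : ∀ a, Y.coact (φ a) = MinTensor.mapRight (ReducedCStar O) φ (X.coact a))
    (hact : ∀ x a, φ (X.act x a) = Y.act x (φ a)) :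
    IsEquivariant X Y φ.toAlgHom.toLinearMap where
  coact a t h := by
    rw [← mapRight_regularEmb, ← h]
    exact hcoact a
  act := hact

end Equivariance

section Rigidity

variable {O : Type u} [Ring O] [StarRing O] [HopfAlgebra ℂ O] [StarModule ℂ O]
  [CompactQuantumGroup O] {A B C : YDAlgebra O}

theorem IsEquivariantUCP.comp {ψ : B →ₗ[ℂ] C} {φ : A →ₗ[ℂ] B} (hψ : IsEquivariantUCP B C ψ)
    (hφ : IsEquivariantUCP A B φ) : IsEquivariantUCP A C (ψ ∘ₗ φ) :=
  ⟨hψ.1.comp hφ.1, hψ.2.comp hφ.2⟩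

theorem IsEquivariantUCP.id : IsEquivariantUCP A A LinearMap.id :=
  ⟨IsUCP.of_starAlgHom (StarAlgHom.id ℂ A), IsEquivariant.id⟩

theorem IsEquivariantUCP.pow {φ : A →ₗ[ℂ] A} (hφ : IsEquivariantUCP A A φ) (n : ℕ) :
    IsEquivariantUCP A A (φ ^ n) := by
  induction n with
  | zero => exact IsEquivariantUCP.id
  | succ n ih => rw [pow_succ']; exact hφ.comp ih

theorem IsEquivariantUCP.convex {φ ψ : A →ₗ[ℂ] B} (hφ : IsEquivariantUCP A B φ)
    (hψ : IsEquivariantUCP A B ψ) {s t : ℝ} (hs : 0 ≤ s) (ht : 0 ≤ t) (hst : s + t = 1) :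
    IsEquivariantUCP A B ((s : ℂ) • φ + (t : ℂ) • ψ) :=
  ⟨hφ.1.convex hψ.1 hs ht hst, hφ.2.linearCombination hψ.2 _ _⟩

/-- The Cesàro means of the powers of `φ`. -/
theorem IsEquivariantUCP.exists_cesaro {φ : A →ₗ[ℂ] A} (hφ : IsEquivariantUCP A A φ) (n : ℕ) :
    ∃ ψ : A →ₗ[ℂ] A, IsEquivariantUCP A A ψ ∧
      ∀ x, ((n + 1 : ℝ) : ℂ) • ψ (x - φ x) = x - (φ ^ (n + 1)) x := by
  induction n with
  | zero => exact ⟨LinearMap.id, IsEquivariantUCP.id, fun x => by simp⟩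
  | succ n ih =>
    obtain ⟨ψ, hψ, h⟩ := ih
    have hn : (0 : ℝ) < n + 2 := by positivity
    -- These weights update the mean of `n + 1` powers to that of `n + 2` powers by adding `φⁿ⁺¹`;
    -- the identity telescopes.
    refine ⟨_, hψ.convex (hφ.pow (n + 1)) (s := (n + 1) / (n + 2)) (t := 1 / (n + 2))
      (by positivity) (by positivity) (by field_simp; ring), fun x => ?_⟩
    have h1 : (((n + 1 : ℕ) + 1 : ℝ) : ℂ) = ((n + 2 : ℝ) : ℂ) := by push_cast; ring
    have h2 : ((n + 2 : ℝ) : ℂ) * (((n + 1) / (n + 2) : ℝ) : ℂ) = ((n + 1 : ℝ) : ℂ) := by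
      rw [← Complex.ofReal_mul]; congr 1; field_simp
    have h3 : ((n + 2 : ℝ) : ℂ) * ((1 / (n + 2) : ℝ) : ℂ) = 1 := by
      rw [← Complex.ofReal_mul, ← Complex.ofReal_one]; congr 1; field_simp
    rw [h1, LinearMap.add_apply, LinearMap.smul_apply, LinearMap.smul_apply, smul_add, smul_smul,
      smul_smul, h2, h3, h, one_smul, map_sub, pow_succ φ (n + 1), Module.End.mul_apply]
    abel

/-- A boundary has no nontrivial equivariant ucp self-maps. -/
theorem IsBoundary.eq_id (hA : IsBoundary A) {φ : A →ₗ[ℂ] A} (hφ : IsEquivariantUCP A A φ) :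
    φ = LinearMap.id := by
  ext x
  rw [LinearMap.id_apply, eq_comm, ← sub_eq_zero, ← norm_eq_zero]
  -- The boundary property is applied to the mean `ψ`, not to `φ`: since `ψ` is isometric, the
  -- telescoped identity bounds `(n + 1)‖x - φ x‖`.
  have hb : ∀ n : ℕ, (n : ℝ) * ‖x - φ x‖ ≤ 2 * ‖x‖ := fun n => by
    obtain ⟨ψ, hψ, h⟩ := hφ.exists_cesaro n
    have h1 := congrArg norm (h x)
    rw [norm_smul, (hA A ψ hψ).norm_map, Complex.norm_real, Real.norm_of_nonneg (by positivity)]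
      at h1
    have h2 : ‖x - (φ ^ (n + 1)) x‖ ≤ 2 * ‖x‖ := by
      refine (norm_sub_le _ _).trans ?_
      have := (hφ.pow (n + 1)).1.norm_le x
      linarith
    nlinarith [norm_nonneg (x - φ x)]
  by_contra h0
  obtain ⟨n, hn⟩ := exists_nat_gt (2 * ‖x‖ / ‖x - φ x‖)
  have hpos : 0 < ‖x - φ x‖ := lt_of_le_of_ne (norm_nonneg _) (Ne.symm h0)
  rw [div_lt_iff₀ hpos] at hn
  exact absurd (hb n) (not_le.2 hn)

end Rigidity

/-! ### Yetter–Drinfeld subalgebras -/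

theorem StarAlgHom.continuous_of_cstarAlgebra {A B : Type*} [CStarAlgebra A] [CStarAlgebra B]
    (f : A →⋆ₐ[ℂ] B) : Continuous f :=
  AddMonoidHomClass.continuous_of_bound f 1 fun a => by
    simpa using NonUnitalStarAlgHom.norm_apply_le f a

/-- A `⋆`-homomorphism factors through an injective one if its range is contained in the range of
the latter. -/
theorem StarAlgHom.exists_lift {A B C : Type*} [CStarAlgebra A] [CStarAlgebra B] [CStarAlgebra C]
    (f : A →⋆ₐ[ℂ] B) (j : C →⋆ₐ[ℂ] B) (hj : Function.Injective j) (h : ∀ a, ∃ c, j c = f a) :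
    ∃ g : A →⋆ₐ[ℂ] C, ∀ a, j (g a) = f a := by
  let e := StarAlgEquiv.ofInjective j hj
  refine ⟨(e.symm : j.range →⋆ₐ[ℂ] C).comp (f.codRestrict j.range fun a => h a), fun a => ?_⟩
  exact congrArg Subtype.val (e.apply_symm_apply (f.codRestrict j.range (fun a => h a) a))

theorem assoc_rTensor_comul_lTensor {O M N : Type*} [AddCommGroup O] [Module ℂ O]
    [Coalgebra ℂ O] [AddCommGroup M] [Module ℂ M]
    [AddCommGroup N] [Module ℂ N] (f : M →ₗ[ℂ] N) (t : O ⊗[ℂ] M) :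
    TensorProduct.assoc ℂ O O N ((Coalgebra.comul (R := ℂ)).rTensor N (f.lTensor O t))
      = (f.lTensor O).lTensor O
        (TensorProduct.assoc ℂ O O M ((Coalgebra.comul (R := ℂ)).rTensor M t)) := by
  induction t with
  | zero => simp
  | add t t' ht ht' => simp only [map_add, ht, ht']
  | tmul x s =>
    rw [LinearMap.rTensor_tmul, LinearMap.lTensor_tmul, LinearMap.rTensor_tmul]
    generalize Coalgebra.comul (R := ℂ) x = w
    induction w with
    | zero => simp
    | add w w' hw hw' => simp only [TensorProduct.add_tmul, map_add, hw, hw']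
    | tmul y z => simp

section Subalgebra

variable {O : Type u} [Ring O] [StarRing O] [HopfAlgebra ℂ O] [StarModule ℂ O]
  [CompactQuantumGroup O] {A : Type u} [CStarAlgebra A]

/-- The restriction of a dual action to an invariant subalgebra. -/
def DualAction.restrict (β : DualAction O A) (S : StarSubalgebra ℂ A) [IsClosed (S : Set A)]
    (h : ∀ x, ∀ s ∈ S, β.act x s ∈ S) : DualAction O S :=
  let act : O →ₐ[ℂ] Module.End ℂ S :=
    AlgHom.ofLinearMap
      { toFun := fun x =>
          { toFun := fun s => ⟨β.act x s, h x s s.2⟩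
            map_add' := fun s t => Subtype.ext (map_add (β.act x) (s : A) t)
            map_smul' := fun c s => Subtype.ext (map_smul (β.act x) c (s : A)) }
        map_add' := fun x y => by ext s; simp
        map_smul' := fun c x => by ext s; simp }
      (by ext s; simp) (fun x y => by ext s; simp)
  have hact : ∀ x s, ((act x s : S) : A) = β.act x s := fun _ _ => rfl
  { act := act
    act_mul := fun x a b => by
      have key : ∀ t : O ⊗[ℂ] O, ((LinearMap.mul' ℂ S (TensorProduct.map (act.toLinearMap.flip a)
          (act.toLinearMap.flip b) t) : S) : A) = LinearMap.mul' ℂ A (TensorProduct.map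
            (β.act.toLinearMap.flip (a : A)) (β.act.toLinearMap.flip (b : A)) t) := fun t => by
        induction t with
        | zero => simp
        | add s t hs ht => simp only [map_add, ← hs, ← ht, AddMemClass.coe_add]
        | tmul y z => simp [hact]
      apply Subtype.ext
      rw [key]
      exact β.act_mul x a b
    act_one := fun x => Subtype.ext (β.act_one x)
    act_star := fun x a => Subtype.ext (β.act_star x a) }

theorem DualAction.restrict_twist (β : DualAction O A) (S : StarSubalgebra ℂ A)
    [IsClosed (S : Set A)] (h : ∀ x, ∀ s ∈ S, β.act x s ∈ S) (w : O ⊗[ℂ] (O ⊗[ℂ] O))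
    (t : O ⊗[ℂ] S) : S.subtype.toAlgHom.toLinearMap.lTensor O ((β.restrict S h).twist w t)
      = β.twist w (S.subtype.toAlgHom.toLinearMap.lTensor O t) := by
  induction w with
  | zero => simp
  | add w w' hw hw' => simp only [map_add, LinearMap.add_apply, hw, hw']
  | tmul x w =>
    induction w with
    | zero => simp
    | add w w' hw hw' => simp only [TensorProduct.tmul_add, map_add, LinearMap.add_apply, hw, hw']
    | tmul y z =>
      induction t with
      | zero => simp
      | add t t' ht ht' => simp only [map_add, ht, ht']
      | tmul v s =>
        rw [DualAction.twist_tmul, LinearMap.lTensor_tmul, LinearMap.lTensor_tmul,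
          DualAction.twist_tmul]
        rfl

/-- The map `ι ⊗ incl` is isometric, so its range is closed. It contains the coaction of a dense set
of elements of `S`, hence of all of them. -/
theorem YDStructure.exists_coact_restrict (X : YDStructure O A) (S : StarSubalgebra ℂ A)
    [IsClosed (S : Set A)]
    (hreg : Dense {s : S | ∃ t : O ⊗[ℂ] S,
      X.coact s = regularEmb O A (S.subtype.toAlgHom.toLinearMap.lTensor O t)}) :
    ∃ g : S →⋆ₐ[ℂ] MinTensor (ReducedCStar O) S,
      ∀ s, MinTensor.mapRight (ReducedCStar O) S.subtype (g s) = X.coact s := by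
  have hiso : Isometry (MinTensor.mapRight (ReducedCStar O) S.subtype) :=
    AddMonoidHomClass.isometry_of_norm _
      (MinTensor.norm_mapRight_of_injective S.subtype Subtype.val_injective)
  refine StarAlgHom.exists_lift (X.coact.comp S.subtype)
    (MinTensor.mapRight (ReducedCStar O) S.subtype) hiso.injective fun s => ?_
  have hcl : IsClosed {s : S | X.coact s ∈ Set.range (MinTensor.mapRight (ReducedCStar O) S.subtype)} :=
    hiso.isClosedEmbedding.isClosed_range.preimage
      (X.coact.continuous_of_cstarAlgebra.comp continuous_subtype_val)
  have hsub : {s : S | ∃ t : O ⊗[ℂ] S,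
      X.coact s = regularEmb O A (S.subtype.toAlgHom.toLinearMap.lTensor O t)} ⊆
      {s : S | X.coact s ∈ Set.range (MinTensor.mapRight (ReducedCStar O) S.subtype)} := by
    rintro s ⟨t, ht⟩
    exact ⟨regularEmb O S t, (mapRight_regularEmb S.subtype t).trans ht.symm⟩
  exact hcl.closure_subset_iff.2 hsub (hreg s)

/-- Coassociativity passes to restrictions. -/
theorem YDStructure.coassoc_restrict (X : YDStructure O A) (S : StarSubalgebra ℂ A)
    [IsClosed (S : Set A)] (g : S →⋆ₐ[ℂ] MinTensor (ReducedCStar O) S)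
    (hg : ∀ s, MinTensor.mapRight (ReducedCStar O) S.subtype (g s) = X.coact s)
    (s : S) (t : O ⊗[ℂ] S) (hst : g s = regularEmb O S t) :
    (regularEmb O S).toLinearMap.lTensor O
        (TensorProduct.assoc ℂ O O S ((Coalgebra.comul (R := ℂ)).rTensor S t))
      = g.toAlgHom.toLinearMap.lTensor O t := by
  have hX := X.coassoc s (S.subtype.toAlgHom.toLinearMap.lTensor O t) (by
    rw [← hg, hst, mapRight_regularEmb])
  let J := (MinTensor.mapRight (ReducedCStar O) S.subtype).toAlgHom.toLinearMap
  have hJ : Function.Injective J :=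
    MinTensor.mapRight_injective S.subtype Subtype.val_injective
  -- Over a field, tensoring with `ℂ[G]` keeps `J` injective, so the identity may be checked in the
  -- ambient algebra.
  refine Module.Flat.lTensor_preserves_injective_linearMap (M := O) J hJ ?_
  have e1 : J ∘ₗ g.toAlgHom.toLinearMap = X.coact.toAlgHom.toLinearMap ∘ₗ
        S.subtype.toAlgHom.toLinearMap := LinearMap.ext hg
  have e2 : J ∘ₗ (regularEmb O S).toLinearMap = (regularEmb O A).toLinearMap ∘ₗ
        S.subtype.toAlgHom.toLinearMap.lTensor O :=
    LinearMap.ext (mapRight_regularEmb S.subtype)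
  have e3 := congrArg (fun f => LinearMap.lTensor O f t) e1
  have e4 := congrArg (fun f => LinearMap.lTensor O f
    (TensorProduct.assoc ℂ O O S ((Coalgebra.comul (R := ℂ)).rTensor S t))) e2
  simp only [LinearMap.lTensor_comp, LinearMap.comp_apply] at e3 e4
  rw [e3, e4, ← hX, assoc_rTensor_comul_lTensor]

/-- The restriction of a Yetter–Drinfeld structure to an invariant subalgebra with sufficiently
many regular elements. -/
def YDStructure.restrict (X : YDStructure O A) (S : StarSubalgebra ℂ A) [IsClosed (S : Set A)]
    (h : ∀ x, ∀ s ∈ S, X.act x s ∈ S)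
    (hreg : Dense {s : S | ∃ t : O ⊗[ℂ] S,
      X.coact s = regularEmb O A (S.subtype.toAlgHom.toLinearMap.lTensor O t)}) :
    YDStructure O S :=
  let g := (X.exists_coact_restrict S hreg).choose
  have hg : ∀ s, MinTensor.mapRight (ReducedCStar O) S.subtype (g s) = X.coact s :=
    (X.exists_coact_restrict S hreg).choose_spec
  have hinj : Function.Injective (MinTensor.mapRight (ReducedCStar O) S.subtype) :=
    MinTensor.mapRight_injective S.subtype Subtype.val_injective
  have hemb : ∀ s t, g s = regularEmb O S t →
      X.coact s = regularEmb O A (S.subtype.toAlgHom.toLinearMap.lTensor O t) := fun s t hst => by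
    rw [← hg, hst, mapRight_regularEmb]
  { X.toDualAction.restrict S h with
    coact := g
    coact_injective := fun s s' hs => Subtype.ext (X.coact_injective (by
      rw [← hg, ← hg, hs]))
    dense_regular := by
      refine hreg.mono ?_
      rintro s ⟨t, ht⟩
      exact ⟨t, hinj (by rw [hg, ht, mapRight_regularEmb])⟩
    coassoc := X.coassoc_restrict S g hg
    yetterDrinfeld := fun x s t hst => by
      refine hinj ?_
      rw [hg, mapRight_regularEmb]
      refine (X.yetterDrinfeld x s _ (hemb s t hst)).trans ?_
      exact congrArg _ (X.toDualAction.restrict_twist S h _ t).symm }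

theorem YDStructure.mapRight_restrict_coact (X : YDStructure O A) (S : StarSubalgebra ℂ A)
    [IsClosed (S : Set A)] (h : ∀ x, ∀ s ∈ S, X.act x s ∈ S)
    (hreg : Dense {s : S | ∃ t : O ⊗[ℂ] S,
      X.coact s = regularEmb O A (S.subtype.toAlgHom.toLinearMap.lTensor O t)}) (s : S) :
    MinTensor.mapRight (ReducedCStar O) S.subtype ((X.restrict S h hreg).coact s) = X.coact s :=
  (X.exists_coact_restrict S hreg).choose_spec s

/-- The Yetter–Drinfeld subalgebra defined by an invariant subalgebra with sufficiently many
regular elements. -/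
def YDSubalgebra.ofInvariant (F : YDAlgebra O) (S : StarSubalgebra ℂ F) (hS : IsClosed (S : Set F))
    (h : ∀ x, ∀ s ∈ S, F.str.act x s ∈ S)
    (hreg : Dense {s : S | ∃ t : O ⊗[ℂ] S,
      F.str.coact s = regularEmb O F (S.subtype.toAlgHom.toLinearMap.lTensor O t)}) :
    YDSubalgebra F where
  toStarSubalgebra := S
  isClosed := hS
  str := F.str.restrict S h hreg
  equivariant := IsEquivariant.of_starAlgHom S.subtype
    (fun s => (F.str.mapRight_restrict_coact S h hreg s).symm) fun _ _ => rfl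

end Subalgebra

/-! ### Equivariance and embeddings -/

section Equivariance

variable {O : Type u} [Ring O] [StarRing O] [HopfAlgebra ℂ O] [StarModule ℂ O]
  [CompactQuantumGroup O] {A B C : Type u} [CStarAlgebra A] [CStarAlgebra B] [CStarAlgebra C]
  {X : YDStructure O A} {Y : YDStructure O B} {Z : YDStructure O C}

/-- An equivariant `⋆`-homomorphism intertwines the coactions. -/
theorem IsEquivariant.coact_apply {φ : A →⋆ₐ[ℂ] B}
    (h : IsEquivariant X Y φ.toAlgHom.toLinearMap) (a : A) :
    Y.coact (φ a) = MinTensor.mapRight (ReducedCStar O) φ (X.coact a) := by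
  have hcl : IsClosed {a | Y.coact (φ a) = MinTensor.mapRight (ReducedCStar O) φ (X.coact a)} :=
    isClosed_eq (Y.coact.continuous_of_cstarAlgebra.comp φ.continuous_of_cstarAlgebra)
      ((MinTensor.continuous_mapRight φ).comp X.coact.continuous_of_cstarAlgebra)
  refine hcl.closure_subset_iff.2 ?_ (X.dense_regular a)
  rintro a ⟨t, ht⟩
  rw [Set.mem_ofPred_eq, ht, mapRight_regularEmb]
  exact h.coact a t ht

/-- Equivariance can be checked after composition with an equivariant embedding. -/
theorem IsEquivariant.of_comp_injective {ψ : B →⋆ₐ[ℂ] C} (hi : Function.Injective ψ)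
    (hψ : IsEquivariant Y Z ψ.toAlgHom.toLinearMap) {φ : A →ₗ[ℂ] B}
    (h : IsEquivariant X Z (ψ.toAlgHom.toLinearMap ∘ₗ φ)) : IsEquivariant X Y φ where
  coact a t hat := by
    refine MinTensor.mapRight_injective (C := ReducedCStar O) ψ hi ?_
    rw [mapRight_regularEmb, ← hψ.coact_apply, ← LinearMap.comp_apply, ← LinearMap.lTensor_comp]
    exact h.coact a t hat
  act x a := hi ((h.act x a).trans (hψ.act x (φ a)).symm)

end Equivariance

theorem DualAction.act_algebraMap {O : Type u} [Ring O] [StarRing O] [HopfAlgebra ℂ O]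
    {A : Type u} [CStarAlgebra A] (β : DualAction O A) (x : O) (c : ℂ) :
    β.act x (algebraMap ℂ A c) = algebraMap ℂ A (c * Coalgebra.counit (R := ℂ) x) := by
  rw [Algebra.algebraMap_eq_smul_one, map_smul, β.act_one, smul_smul,
    Algebra.algebraMap_eq_smul_one]

/-! ### Consequences of injectivity and rigidity -/

section Injective

variable {O : Type u} [Ring O] [StarRing O] [HopfAlgebra ℂ O] [StarModule ℂ O]
  [CompactQuantumGroup O] {F : YDAlgebra O}

/-- The inclusion of a Yetter–Drinfeld subalgebra. -/
def YDSubalgebra.incl (S : YDSubalgebra F) : S.toYDAlgebra →⋆ₐ[ℂ] F :=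
  S.toStarSubalgebra.subtype

theorem YDSubalgebra.incl_injective (S : YDSubalgebra F) : Function.Injective S.incl :=
  Subtype.val_injective

theorem YDSubalgebra.isEquivariantUCP_incl (S : YDSubalgebra F) :
    IsEquivariantUCP S.toYDAlgebra F S.incl.toAlgHom.toLinearMap :=
  ⟨IsUCP.of_starAlgHom S.incl, S.equivariant⟩

theorem YDSubalgebra.isCompletelyIsometric_incl (S : YDSubalgebra F) :
    IsCompletelyIsometric S.incl.toAlgHom.toLinearMap :=
  IsCompletelyIsometric.of_starAlgHom S.incl S.incl_injective

variable (F) in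
/-- The subalgebra of scalars. -/
def YDSubalgebra.scalars : YDSubalgebra F :=
  YDSubalgebra.ofInvariant F (StarAlgHom.ofId ℂ F).range
    (algebraMap_isometry ℂ F).isClosedEmbedding.isClosed_range
    (by
      rintro x _ ⟨c, rfl⟩
      exact ⟨_, (F.str.act_algebraMap x c).symm⟩)
    (by
      refine dense_iff_closure_eq.2 (Set.eq_univ_of_forall fun s => subset_closure ?_)
      obtain ⟨_, c, rfl⟩ := s
      refine ⟨1 ⊗ₜ algebraMap ℂ _ c, ?_⟩
      rw [LinearMap.lTensor_tmul]
      have h1 : F.str.coact (algebraMap ℂ F c) = algebraMap ℂ _ c := AlgHomClass.commutes _ c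
      refine h1.trans ?_
      rw [← AlgHomClass.commutes (regularEmb O F) c]
      congr 1
      rw [Algebra.algebraMap_eq_smul_one, Algebra.TensorProduct.one_def, ← TensorProduct.tmul_smul,
        ← Algebra.algebraMap_eq_smul_one]
      rfl)

/-- This supplies an embedding along which injectivity of `F` can be applied for an arbitrary target
`B`. Both actions are trivial on scalars, and injectivity uses that `B` is nonzero. -/
theorem YDSubalgebra.exists_scalars_map (B : YDAlgebra O) :
    ∃ φ : (scalars F).toYDAlgebra →ₗ[ℂ] B,
      IsEquivariantUCP (scalars F).toYDAlgebra B φ ∧ IsCompletelyIsometric φ := by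
  let e := StarAlgEquiv.ofInjective (StarAlgHom.ofId ℂ F) (algebraMap_isometry ℂ F).injective
  let φ : (scalars F).toYDAlgebra →⋆ₐ[ℂ] B :=
    (StarAlgHom.ofId ℂ B).comp (e.symm : (StarAlgHom.ofId ℂ F).range →⋆ₐ[ℂ] ℂ)
  have hφ : Function.Injective φ := (algebraMap_isometry ℂ B).injective.comp e.symm.injective
  have hsurj : ∀ s : (scalars F).toYDAlgebra, ∃ c, s = algebraMap ℂ _ c := by
    rintro ⟨_, c, rfl⟩
    exact ⟨c, rfl⟩
  refine ⟨φ.toAlgHom.toLinearMap, ⟨IsUCP.of_starAlgHom φ,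
    IsEquivariant.of_starAlgHom φ (fun s => ?_) fun x s => ?_⟩,
    IsCompletelyIsometric.of_starAlgHom φ hφ⟩
  · obtain ⟨c, rfl⟩ := hsurj s
    rw [AlgHomClass.commutes, AlgHomClass.commutes, AlgHomClass.commutes, AlgHomClass.commutes]
  · obtain ⟨c, rfl⟩ := hsurj s
    rw [DualAction.act_algebraMap, AlgHomClass.commutes, AlgHomClass.commutes,
      DualAction.act_algebraMap]

/-- Extend the inclusion of the scalars into `F` along their embedding into `B`. -/
theorem IsDGInjective.exists_map (hF : IsDGInjective F) (B : YDAlgebra O) :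
    ∃ ψ : B →ₗ[ℂ] F, IsEquivariantUCP B F ψ := by
  obtain ⟨φ, hφ, hi⟩ := YDSubalgebra.exists_scalars_map (F := F) B
  obtain ⟨ψ, hψ, -⟩ := hF _ _ φ _ hφ hi (YDSubalgebra.scalars F).isEquivariantUCP_incl
  exact ⟨ψ, hψ⟩

/-- Injectivity extends `χ` to an equivariant ucp self-map of `F`, which rigidity identifies with
the identity. -/
theorem IsFurstenbergHamanaBoundary.eq_incl (hF : IsFurstenbergHamanaBoundary F)
    (S : YDSubalgebra F) {χ : S.toYDAlgebra →ₗ[ℂ] F} (hχ : IsEquivariantUCP S.toYDAlgebra F χ) :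
    χ = S.incl.toAlgHom.toLinearMap := by
  obtain ⟨χ', hχ', h⟩ := hF.2 _ _ _ χ S.isEquivariantUCP_incl S.isCompletelyIsometric_incl hχ
  rw [← h, hF.1.eq_id hχ', LinearMap.id_comp]

/-- Following `χ` by some equivariant ucp map `θ : B → F` gives the inclusion of `S`; since `θ`
cannot increase norms, `χ` cannot decrease them. -/
theorem IsFurstenbergHamanaBoundary.isBoundary_subalgebra (hF : IsFurstenbergHamanaBoundary F)
    (S : YDSubalgebra F) : IsBoundary S.toYDAlgebra := by
  intro B χ hχ
  obtain ⟨θ, hθ⟩ := hF.2.exists_map B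
  refine IsCompletelyIsometric.of_comp hθ.1 hχ.1 ?_
  rw [hF.eq_incl S (hθ.comp hχ)]
  exact S.isCompletelyIsometric_incl

theorem IsFurstenbergHamanaBoundary.coe_apply (hF : IsFurstenbergHamanaBoundary F)
    {S T : YDSubalgebra F} {φ : S.toYDAlgebra →ₗ[ℂ] T.toYDAlgebra}
    (hφ : IsEquivariantUCP S.toYDAlgebra T.toYDAlgebra φ) (s : S.toYDAlgebra) :
    T.incl (φ s) = S.incl s :=
  congrArg (fun f => f s) (hF.eq_incl S (T.isEquivariantUCP_incl.comp hφ))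

theorem YDSubalgebra.isEquivariantUCP_inclusion {S T : YDSubalgebra F}
    (h : S.toStarSubalgebra ≤ T.toStarSubalgebra) :
    IsEquivariantUCP S.toYDAlgebra T.toYDAlgebra (YDSubalgebra.inclusion h) :=
  let i : S.toYDAlgebra →⋆ₐ[ℂ] T.toYDAlgebra := StarSubalgebra.inclusion h
  ⟨IsUCP.of_starAlgHom i, IsEquivariant.of_comp_injective T.incl_injective
    T.isEquivariantUCP_incl.2 S.isEquivariantUCP_incl.2⟩

/-- Precompose a map out of `A` with the inverse isomorphism, then transport matrices over `A` to
`B`. -/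
theorem IsBoundary.of_isIsomorphic {A B : YDAlgebra O} (h : A.IsIsomorphic B)
    (hB : IsBoundary B) : IsBoundary A := by
  obtain ⟨e, he⟩ := h
  intro C ψ hψ
  let i : B →⋆ₐ[ℂ] A := (e.symm : B →⋆ₐ[ℂ] A)
  have hi : IsEquivariantUCP B A i.toAlgHom.toLinearMap := by
    refine ⟨IsUCP.of_starAlgHom i, IsEquivariant.of_comp_injective (ψ := (e : A →⋆ₐ[ℂ] B))
      e.injective he ?_⟩
    convert IsEquivariant.id (X := B.str) using 1
    ext b
    exact e.apply_symm_apply b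
  have h1 := hB C _ (hψ.comp hi)
  have h2 := IsCompletelyIsometric.of_starAlgHom (e : A →⋆ₐ[ℂ] B) e.injective
  intro n M
  have h3 := h1 n (M.map (e : A →⋆ₐ[ℂ] B).toAlgHom.toLinearMap)
  rw [h2 n M] at h3
  rw [← h3]
  congr 1
  ext k l
  exact congrArg ψ (e.symm_apply_apply (M k l)).symm

end Injective

/-- A closed property stable under the `⋆`-algebra operations need only be checked on generators and
scalars, as the algebraic span is dense in its closure. -/
theorem StarSubalgebra.closure_adjoin_induction {B : Type*} [CStarAlgebra B] {s : Set B}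
    {P : (StarAlgebra.adjoin ℂ s).topologicalClosure → Prop} (hcl : IsClosed {x | P x})
    (mem : ∀ x : (StarAlgebra.adjoin ℂ s).topologicalClosure, (x : B) ∈ s → P x)
    (algebraMap : ∀ c, P (algebraMap ℂ _ c))
    (add : ∀ x y, P x → P y → P (x + y)) (mul : ∀ x y, P x → P y → P (x * y))
    (star : ∀ x, P x → P (star x)) (x : (StarAlgebra.adjoin ℂ s).topologicalClosure) : P x := by
  have hle := StarSubalgebra.le_topologicalClosure (StarAlgebra.adjoin ℂ s)
  have key : ∀ y (hy : y ∈ StarAlgebra.adjoin ℂ s), P ⟨y, hle hy⟩ := fun y hy => by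
    induction hy using StarAlgebra.adjoin_induction with
    | mem y hy => exact mem _ hy
    | algebraMap c => exact algebraMap c
    | add y z _ _ hy hz => exact add _ _ hy hz
    | mul y z _ _ hy hz => exact mul _ _ hy hz
    | star y _ hy => exact star _ hy
  have hsub : {y : (StarAlgebra.adjoin ℂ s).topologicalClosure |
      (y : B) ∈ StarAlgebra.adjoin ℂ s} ⊆ {x | P x} := fun y hy => key y hy
  refine hcl.closure_subset_iff.2 hsub (closure_subtype.2 (closure_mono ?_ x.2))
  exact fun y hy => ⟨⟨y, hle hy⟩, hy, rfl⟩

/-! ### The multiplicative left inverse of a complete isometry -/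

section LeftInverse

variable {A B : Type u} [CStarAlgebra A] [CStarAlgebra B]

/-- The closed `⋆`-algebra generated by the graph of a completely isometric ucp map is the graph of
a map defined on the second coordinates. -/
theorem IsCompletelyIsometric.fst_eq_zero_of_snd_eq_zero {ψ : A →ₗ[ℂ] B} (hψ : IsUCP ψ)
    (hi : IsCompletelyIsometric ψ)
    (d : (StarAlgebra.adjoin ℂ (Set.range fun a => (a, ψ a))).topologicalClosure)
    (hd : (d : A × B).2 = 0) : (d : A × B).1 = 0 := by
  refine norm_le_zero_iff.1 (HilbertRep.norm_le_of_forall le_rfl fun σ => norm_le_zero_iff.2 ?_)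
  obtain ⟨τ, V, hV⟩ := HilbertRep.exists_extension hψ hi σ
  -- Intertwining by `V` does not pass to adjoints, since the range of `V` is not known to reduce
  -- `τ`. The induction therefore carries the relation for the adjoint pair as well; on generators
  -- it holds because `ψ(a)⋆ = ψ(a⋆)`.
  have key : ∀ k, τ.hom (d : A × B).2 (V k) = V (σ.hom (d : A × B).1 k) ∧
      τ.hom (star (d : A × B).2) (V k) = V (σ.hom (star (d : A × B).1) k) := by
    have hτ := τ.hom.continuous_of_cstarAlgebra
    have hσ := σ.hom.continuous_of_cstarAlgebra
    refine StarSubalgebra.closure_adjoin_induction (P := fun d =>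
      ∀ k, τ.hom (d : A × B).2 (V k) = V (σ.hom (d : A × B).1 k) ∧
      τ.hom (star (d : A × B).2) (V k) = V (σ.hom (star (d : A × B).1) k)) ?_ ?_ ?_ ?_ ?_ ?_ d
    · simp only [Set.ofPred_forall, Set.ofPred_and]
      refine isClosed_iInter fun k => (isClosed_eq ?_ ?_).inter (isClosed_eq ?_ ?_)
      · exact (hτ.comp (continuous_snd.comp continuous_subtype_val)).clm_apply continuous_const
      · exact V.continuous.comp
          ((hσ.comp (continuous_fst.comp continuous_subtype_val)).clm_apply continuous_const)
      · exact (hτ.comp (continuous_snd.comp continuous_subtype_val).star).clm_apply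
          continuous_const
      · exact V.continuous.comp
          ((hσ.comp (continuous_fst.comp continuous_subtype_val).star).clm_apply continuous_const)
    · rintro ⟨_, hx⟩ ⟨a, rfl⟩ k
      refine ⟨hV a k, ?_⟩
      change τ.hom (star (ψ a)) (V k) = V (σ.hom (star a) k)
      rw [← hψ.map_star, hV]
    · intro c k
      change τ.hom (algebraMap ℂ B c) (V k) = V (σ.hom (algebraMap ℂ A c) k) ∧
        τ.hom (star (algebraMap ℂ B c)) (V k) = V (σ.hom (star (algebraMap ℂ A c)) k)
      simp only [map_star, Algebra.algebraMap_eq_smul_one]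
      simp
    · intro x y hx hy k
      simp only [AddMemClass.coe_add, Prod.fst_add, Prod.snd_add, star_add, map_add, _root_.add_apply,
        (hx k).1, (hy k).1, (hx k).2, (hy k).2, and_self]
    · intro x y hx hy k
      simp only [MulMemClass.coe_mul, Prod.fst_mul, Prod.snd_mul, star_mul, map_mul,
        mul_apply_eq_comp, (hy _).1, (hx _).1, (hy _).2, (hx _).2, and_self]
    · intro x hx k
      change τ.hom (star (x : A × B).2) (V k) = V (σ.hom (star (x : A × B).1) k) ∧
        τ.hom (star (star (x : A × B).2)) (V k) = V (σ.hom (star (star (x : A × B).1)) k)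
      rw [star_star, star_star]
      exact ⟨(hx k).2, (hx k).1⟩
  ext k
  refine V.injective ?_
  rw [← (key k).1, hd]
  simp

/-- The C⋆-algebra generated by the image of a linear map. -/
abbrev LinearMap.generated (ψ : A →ₗ[ℂ] B) : StarSubalgebra ℂ B :=
  (StarAlgebra.adjoin ℂ (Set.range ψ)).topologicalClosure

instance (ψ : A →ₗ[ℂ] B) : IsClosed (ψ.generated : Set B) :=
  StarSubalgebra.isClosed_topologicalClosure _

theorem LinearMap.mem_generated (ψ : A →ₗ[ℂ] B) (a : A) : ψ a ∈ ψ.generated :=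
  StarSubalgebra.le_topologicalClosure _ (StarAlgebra.subset_adjoin ℂ _ ⟨a, rfl⟩)

/-- A completely isometric ucp map has a multiplicative left inverse on the C⋆-algebra generated by
its image. -/
theorem IsCompletelyIsometric.exists_leftInverse {ψ : A →ₗ[ℂ] B} (hψ : IsUCP ψ)
    (hi : IsCompletelyIsometric ψ) :
    ∃ π : ψ.generated →⋆ₐ[ℂ] A,
      ∀ a (s : ψ.generated), (s : B) = ψ a → π s = a := by
  set D := (StarAlgebra.adjoin ℂ (Set.range fun a => (a, ψ a))).topologicalClosure
  have : IsClosed (D : Set (A × B)) := StarSubalgebra.isClosed_topologicalClosure _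
  let p : D →⋆ₐ[ℂ] A := (StarAlgHom.fst ℂ A B).comp D.subtype
  let q : D →⋆ₐ[ℂ] B := (StarAlgHom.snd ℂ A B).comp D.subtype
  have hpq : ∀ d : D, q d = 0 → p d = 0 := fun d hd =>
    IsCompletelyIsometric.fst_eq_zero_of_snd_eq_zero hψ hi d hd
  have hq : Function.Injective q := (injective_iff_map_eq_zero q).2 fun d hd =>
    Subtype.ext (Prod.ext (hpq d hd) hd)
  have hqcl : IsClosed (q.range : Set B) :=
    (NonUnitalStarAlgHom.isometry q hq).isClosedEmbedding.isClosed_range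
  have hmem : ∀ a, (a, ψ a) ∈ D := fun a =>
    StarSubalgebra.le_topologicalClosure _ (StarAlgebra.subset_adjoin ℂ _ ⟨a, rfl⟩)
  -- The second projection of `D` is injective with closed range, so it can be inverted on the
  -- generated algebra; following by the first projection gives `π`.
  have hle : ψ.generated ≤ q.range := by
    refine StarSubalgebra.topologicalClosure_minimal (StarAlgebra.adjoin_le ?_) hqcl
    rintro _ ⟨a, rfl⟩
    exact ⟨⟨_, hmem a⟩, rfl⟩
  obtain ⟨g, hg⟩ := StarAlgHom.exists_lift
    ψ.generated.subtype q hq fun s => hle s.2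
  refine ⟨p.comp g, fun a s hs => ?_⟩
  have : g s = ⟨_, hmem a⟩ := hq ((hg s).trans hs)
  change p (g s) = a
  rw [this]
  rfl

end LeftInverse

/-! ### Invariance and regularity of the generated algebra -/

section Generated

variable {O : Type u} [Ring O] [StarRing O] [HopfAlgebra ℂ O] [StarModule ℂ O]
  [CompactQuantumGroup O] {A B : Type u} [CStarAlgebra A] [CStarAlgebra B]
  {X : YDStructure O A} {Y : YDStructure O B} {ψ : A →ₗ[ℂ] B}

/-- The C⋆-algebra generated by the image of `ψ` is invariant under the module action if it contains
the translates of this image. -/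
theorem DualAction.act_mem_of_mem_generated (β : DualAction O B)
    (h : ∀ x a, β.act x (ψ a) ∈ ψ.generated) (x : O) (b : B) (hb : b ∈ ψ.generated) :
    β.act x b ∈ ψ.generated := by
  revert x
  refine StarSubalgebra.closure_adjoin_induction (P := fun b : ψ.generated =>
    ∀ x, β.act x b ∈ ψ.generated) ?_ ?_ ?_ ?_ ?_ ?_ ⟨b, hb⟩
  · simp only [Set.ofPred_forall]
    exact isClosed_iInter fun x => IsClosed.preimage
      ((β.continuous_act x).comp continuous_subtype_val)
      (StarSubalgebra.isClosed_topologicalClosure _)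
  · rintro b ⟨a, ha⟩ x
    rw [← ha]
    exact h x a
  · intro c x
    have := β.act_algebraMap x c
    change β.act x (algebraMap ℂ B c) ∈ _
    rw [this]
    exact algebraMap_mem _ _
  · intro b c hb hc x
    rw [AddMemClass.coe_add, map_add]
    exact add_mem (hb x) (hc x)
  · intro b c hb hc x
    rw [MulMemClass.coe_mul, β.act_mul]
    generalize Coalgebra.comul (R := ℂ) x = t
    induction t with
    | zero => simp
    | add s t hs ht => simpa only [map_add] using add_mem hs ht
    | tmul y z => exact mul_mem (hb y) (hc z)
  · intro b hb x
    rw [StarMemClass.coe_star, β.act_star]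
    exact star_mem (hb _)

/-- The regular elements are dense in the C⋆-algebra generated by the image of an equivariant
map. -/
theorem IsEquivariant.dense_regular_generated (hψ : IsEquivariant X Y ψ) (hc : Continuous ψ) :
    Dense {s : ψ.generated | ∃ t : O ⊗[ℂ] ψ.generated,
      Y.coact s = regularEmb O B (ψ.generated.subtype.toAlgHom.toLinearMap.lTensor O t)} := by
  let f : O ⊗[ℂ] ψ.generated →⋆ₐ[ℂ] MinTensor (ReducedCStar O) B :=
    { toAlgHom := (MinTensor.mapRight (ReducedCStar O) ψ.generated.subtype).toAlgHom.comp
        (regularEmb O ψ.generated)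
      map_star' := fun t => by
        change MinTensor.mapRight (ReducedCStar O) _ (regularEmb O _ (star t)) =
          star (MinTensor.mapRight (ReducedCStar O) _ (regularEmb O _ t))
        rw [regularEmb_star, map_star] }
  have hf : ∀ t, f t = regularEmb O B (ψ.generated.subtype.toAlgHom.toLinearMap.lTensor O t) :=
    fun t => mapRight_regularEmb ψ.generated.subtype t
  -- The regular elements of the generated algebra form a `⋆`-subalgebra. Its closure is everything
  -- once it contains `ψ(A)`, and `ψ` sends the dense set of regular elements of `A` into it.
  let R : StarSubalgebra ℂ ψ.generated := f.range.comap (Y.coact.comp ψ.generated.subtype)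
  have key : ∀ s, s ∈ R.topologicalClosure := by
    refine StarSubalgebra.closure_adjoin_induction
      (StarSubalgebra.isClosed_topologicalClosure R) ?_ (fun c => algebraMap_mem _ c)
      (fun _ _ => add_mem) (fun _ _ => mul_mem) fun _ => star_mem
    rintro ⟨_, hs⟩ ⟨a, rfl⟩
    let ψ' : A →ₗ[ℂ] ψ.generated :=
      ψ.codRestrict ψ.generated.toSubalgebra.toSubmodule ψ.mem_generated
    have hψ' : Continuous ψ' := hc.subtype_mk _
    refine map_mem_closure (s := {a | ∃ t, X.coact a = regularEmb O A t}) hψ' (X.dense_regular a) ?_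
    rintro a ⟨t, ht⟩
    refine ⟨ψ'.lTensor O t, (hf _).trans ?_⟩
    rw [← LinearMap.comp_apply, ← LinearMap.lTensor_comp]
    exact (hψ.coact a t ht).symm
  refine fun s => closure_mono ?_ (key s)
  rintro s ⟨t, ht⟩
  exact ⟨t, ht.symm.trans (hf t)⟩

end Generated

/-! ### Embedding boundaries into the Furstenberg–Hamana boundary -/

section Embedding

variable {O : Type u} [Ring O] [StarRing O] [HopfAlgebra ℂ O] [StarModule ℂ O]
  [CompactQuantumGroup O] {A F : YDAlgebra O}

/-- The Yetter–Drinfeld subalgebra generated by the image of an equivariant ucp map. -/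
def IsEquivariantUCP.generated {ψ : A →ₗ[ℂ] F} (hψ : IsEquivariantUCP A F ψ) : YDSubalgebra F :=
  YDSubalgebra.ofInvariant F ψ.generated (StarSubalgebra.isClosed_topologicalClosure _)
    (F.str.act_mem_of_mem_generated fun x a => by
      rw [← hψ.2.act]
      exact ψ.mem_generated _)
    (hψ.2.dense_regular_generated hψ.1.continuous)

/-- An equivariant ucp map, viewed as a map into the subalgebra that its image generates. -/
def IsEquivariantUCP.toGenerated {ψ : A →ₗ[ℂ] F} (hψ : IsEquivariantUCP A F ψ) :
    A →ₗ[ℂ] hψ.generated.toYDAlgebra :=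
  ψ.codRestrict ψ.generated.toSubalgebra.toSubmodule ψ.mem_generated

theorem IsEquivariantUCP.continuous_toGenerated {ψ : A →ₗ[ℂ] F} (hψ : IsEquivariantUCP A F ψ) :
    Continuous hψ.toGenerated :=
  hψ.1.continuous.subtype_mk _

theorem IsEquivariantUCP.isEquivariant_toGenerated {ψ : A →ₗ[ℂ] F} (hψ : IsEquivariantUCP A F ψ) :
    IsEquivariant A.str hψ.generated.toYDAlgebra.str hψ.toGenerated :=
  IsEquivariant.of_comp_injective hψ.generated.incl_injective
    hψ.generated.isEquivariantUCP_incl.2 hψ.2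

theorem IsEquivariantUCP.generated_induction {ψ : A →ₗ[ℂ] F} (hψ : IsEquivariantUCP A F ψ)
    {P : hψ.generated.toYDAlgebra → Prop} (hcl : IsClosed {x | P x})
    (mem : ∀ a, P (hψ.toGenerated a)) (algebraMap : ∀ c, P (algebraMap ℂ _ c))
    (add : ∀ x y, P x → P y → P (x + y)) (mul : ∀ x y, P x → P y → P (x * y))
    (star : ∀ x, P x → P (star x)) (x : hψ.generated.toYDAlgebra) : P x := by
  refine StarSubalgebra.closure_adjoin_induction (P := P) hcl ?_ algebraMap add mul star x
  rintro ⟨_, hx⟩ ⟨a, rfl⟩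
  exact mem a

/-- A multiplicative left inverse of an equivariant ucp map is equivariant. -/
theorem IsEquivariantUCP.isEquivariant_leftInverse {ψ : A →ₗ[ℂ] F} (hψ : IsEquivariantUCP A F ψ)
    (π : hψ.generated.toYDAlgebra →⋆ₐ[ℂ] A) (hπ : ∀ a, π (hψ.toGenerated a) = a) :
    IsEquivariant hψ.generated.toYDAlgebra.str A.str π.toAlgHom.toLinearMap := by
  have hπc : Continuous π := π.continuous_of_cstarAlgebra
  refine IsEquivariant.of_starAlgHom (X := hψ.generated.toYDAlgebra.str) π (fun s => ?_)
    fun x s => ?_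
  · have hcl : IsClosed {s | A.str.coact (π s) =
        MinTensor.mapRight (ReducedCStar O) π (hψ.generated.toYDAlgebra.str.coact s)} :=
      isClosed_eq (A.str.coact.continuous_of_cstarAlgebra.comp hπc)
        ((MinTensor.continuous_mapRight π).comp
          hψ.generated.toYDAlgebra.str.coact.continuous_of_cstarAlgebra)
    refine hψ.generated_induction hcl (fun a => ?_) (fun c => ?_) (fun s t hs ht => ?_)
      (fun s t hs ht => ?_) (fun s hs => ?_) s
    -- On a generator `ψ(a)` equivariance is available only for regular `a`, where `πψ = ι` finishes
    -- the computation; density and continuity give all `a`.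
    · refine (hcl.preimage hψ.continuous_toGenerated).closure_subset_iff.2 ?_
        (A.str.dense_regular a)
      rintro a ⟨t, ht⟩
      change A.str.coact (π (hψ.toGenerated a)) =
        MinTensor.mapRight (ReducedCStar O) π (hψ.generated.toYDAlgebra.str.coact (hψ.toGenerated a))
      rw [hπ, hψ.isEquivariant_toGenerated.coact a t ht, mapRight_regularEmb,
        ← LinearMap.comp_apply, ← LinearMap.lTensor_comp, ht]
      have : π.toAlgHom.toLinearMap ∘ₗ hψ.toGenerated = LinearMap.id := LinearMap.ext hπ
      rw [this, LinearMap.lTensor_id, LinearMap.id_apply]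
    · simp only [AlgHomClass.commutes]
    · simp only [map_add, hs, ht]
    · simp only [map_mul, hs, ht]
    · simp only [map_star, hs]
  · revert x
    refine hψ.generated_induction (P := fun s =>
        ∀ x, π (hψ.generated.toYDAlgebra.str.act x s) = A.str.act x (π s)) ?_
      (fun a x => ?_) (fun c x => ?_) (fun s t hs ht x => ?_) (fun s t hs ht x => ?_)
      (fun s hs x => ?_) s
    · simp only [Set.ofPred_forall]
      exact isClosed_iInter fun x => isClosed_eq
        (hπc.comp (hψ.generated.toYDAlgebra.str.continuous_act x))
        ((A.str.continuous_act x).comp hπc)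
    · rw [← hψ.isEquivariant_toGenerated.act, hπ, hπ]
    · rw [DualAction.act_algebraMap, AlgHomClass.commutes, AlgHomClass.commutes,
        DualAction.act_algebraMap]
    · simp only [map_add, hs, ht]
    · rw [map_mul π, DualAction.act_mul, DualAction.act_mul]
      generalize Coalgebra.comul (R := ℂ) x = w
      induction w with
      | zero => simp
      | add w w' hw hw' => simp only [map_add, hw, hw']
      | tmul y z => simp [hs, ht]
    · rw [DualAction.act_star, map_star π, map_star π, DualAction.act_star, hs]

/-- Boundaries embed into the Furstenberg–Hamana boundary. -/
theorem IsFurstenbergHamanaBoundary.exists_isIsomorphic (hF : IsFurstenbergHamanaBoundary F)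
    (hA : IsBoundary A) : ∃ S : YDSubalgebra F, A.IsIsomorphic S.toYDAlgebra := by
  obtain ⟨ψ, hψ⟩ := hF.2.exists_map A
  obtain ⟨π, hπ⟩ := (hA F ψ hψ).exists_leftInverse hψ.1
  let π : hψ.generated.toYDAlgebra →⋆ₐ[ℂ] A := π
  have hπ : ∀ a, π (hψ.toGenerated a) = a := fun a => hπ a _ rfl
  have hπe := hψ.isEquivariant_leftInverse π hπ
  -- The boundary property is now used for the generated subalgebra: `π` is an equivariant ucp map
  -- out of it, hence isometric.
  have hinj : Function.Injective π :=
    (hF.isBoundary_subalgebra hψ.generated A _ ⟨IsUCP.of_starAlgHom π, hπe⟩).injective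
  let e : hψ.generated.toYDAlgebra ≃⋆ₐ[ℂ] A :=
    StarAlgEquiv.ofBijective π ⟨hinj, fun a => ⟨_, hπ a⟩⟩
  refine ⟨hψ.generated, e.symm, IsEquivariant.of_comp_injective hinj hπe ?_⟩
  convert IsEquivariant.id (X := A.str) using 1
  ext a
  exact e.apply_symm_apply a

end Embedding

end

theorem theorem2p8 {O : Type u} [Ring O] [StarRing O] [HopfAlgebra ℂ O] [StarModule ℂ O]
    [CompactQuantumGroup O] (F : YDAlgebra O) (hF : IsFurstenbergHamanaBoundary F) :
    (∀ A : YDAlgebra O, IsBoundary A ↔ ∃ S : YDSubalgebra F, A.IsIsomorphic S.toYDAlgebra) ∧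
    ∀ S₁ S₂ : YDSubalgebra F,
      (∀ (h : S₁.toStarSubalgebra ≤ S₂.toStarSubalgebra)
        (φ : S₁.toYDAlgebra →ₗ[ℂ] S₂.toYDAlgebra),
          IsEquivariantUCP S₁.toYDAlgebra S₂.toYDAlgebra φ ↔ φ = YDSubalgebra.inclusion h) ∧
      (¬ S₁.toStarSubalgebra ≤ S₂.toStarSubalgebra →
        ¬ ∃ φ : S₁.toYDAlgebra →ₗ[ℂ] S₂.toYDAlgebra,
          IsEquivariantUCP S₁.toYDAlgebra S₂.toYDAlgebra φ) := by
  refine ⟨fun A => ⟨hF.exists_isIsomorphic, ?_⟩, fun S₁ S₂ => ⟨fun h φ => ⟨fun hφ => ?_, ?_⟩, ?_⟩⟩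
  · rintro ⟨S, hS⟩
    exact IsBoundary.of_isIsomorphic hS (hF.isBoundary_subalgebra S)
  · exact LinearMap.ext fun s => S₂.incl_injective (hF.coe_apply hφ s)
  · rintro rfl
    exact YDSubalgebra.isEquivariantUCP_inclusion h
  · rintro h ⟨φ, hφ⟩
    -- Any map sends `s` to itself inside `F`, while its value lies in the second subalgebra; so its
    -- existence forces the inclusion.
    refine h fun s hs => ?_
    have h1 : S₂.incl (φ ⟨s, hs⟩) = s := hF.coe_apply hφ ⟨s, hs⟩
    rw [← h1]
    exact (φ ⟨s, hs⟩).2
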